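/- **Call-by-push-value (CBPV).** Value types $A$ and computation types $\underline C$ are $$A ::= \mathsf{unit}\mid A_1\times A_2\mid \mathsf{bool}\mid \mathbf U\underline C,\qquad \underline C ::= \underline C_1\,\Pi\,\underline C_2\mid A\to\underline C\mid \mathbf F A .$$ The terms, taken up to renaming of bound variables and typed by the usual rules, are - values $\Gamma\vdash V:A$: $\ x\mid ()\mid (V_1,V_2)\mid \mathsf{true}\mid\mathsf{false}\mid\mathsf{thunk}\,M$; - computations $\Gamma\vdash M:\underline C$: $\ \lambda\{M_1,M_2\}\mid 1{}^{\backprime}M\mid 2{}^{\backprime}M\mid\lambda x{:}A.\,M\mid V{}^{\backprime}M\mid\mathsf{return}\,V\mid M\;\mathsf{to}\;x.\,N\mid\mathsf{match}\,V\,\mathsf{with}\,(x_1,x_2).M\mid\mathsf{if}\,V\,\mathsf{then}\,M_1\,\mathsf{else}\,M_2\mid\mathsf{force}\,V$. Here $\lambda\{M_1,M_2\}:\underline C_1\,\Pi\,\underline C_2$ is a lazy pair with projections $i{}^{\backprime}M$, and $V{}^{\backprime}M$ applies $M:A\to\underline C$ to $V:A$. **Program relations and the contextual preorder.** Ground types are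 $G::=\mathsf{unit}\mid\mathsf{bool}\mid G_1\times G_2$. A *program relation* $\preccurlyeq$ is a preorder on the closed computations of type $\mathbf FG$, for each ground type $G$. For $\Gamma\vdash M,M':\underline C$, write $M\lesssim_\Gamma M'$ if $\mathcal E[M]\preccurlyeq\mathcal E[M']$ for every ground type $G$ and every closed computation context $\mathcal E$ of type $\mathbf FG$ with a single hole for computations $\Gamma\vdash\cdot:\underline C$. (The hole may lie in any typing context that contains the variables of $\Gamma$, and filling it may capture variables.) **Models.** A *$\mathbf{Poset}$-category* is a category with a partial order on each hom-set for which composition is monotone. It is *cartesian closed* if its underlying category is, with monotone pairing and monotone currying $\mathcal C(W\times X,Y)\to\mathcal C(W,X\Rightarrow Y)$. A *strong $\mathbf{Poset}$-monad* $\mathsf T$ consists of objects $TX$, morphisms $\eta_X:X\to TX$, and monotone maps $(-)^\dagger:\mathcal C(W\times X,TY)\to\mathcal C(W\times TX,TY)$, natural in $W$, such that (with $a$ the associativity isomorphism of products) $$f^\dagger\circ(W\times\eta_X)=f,\qquad (\eta_X\circ\pi_2)^\dagger=\pi_2:1\times TX\to TX,\qquad \bigl(g^\dagger\circ(W'\times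 f)\circ a\bigr)^\dagger=g^\dagger\circ(W'\times f^\dagger)\circ a .$$ A *$\mathsf T$-algebra* is an object $Z$ with monotone maps $(-)^\ddagger:\mathcal C(W\times X,Z)\to\mathcal C(W\times TX,Z)$, natural in $W$, such that $f^\ddagger\circ(W\times\eta_X)=f$ and $(g^\ddagger\circ(W'\times f)\circ a)^\ddagger=g^\ddagger\circ(W'\times f^\dagger)\circ a$ for $f:W\times X\to TY$, $g:W'\times Y\to Z$. For $f:X\to Y$, $Tf:TX\to TY$ is the extension (with $W=1$) of $\eta_Y\circ f$. The monad is *lax idempotent* if $T\eta_Y\le\eta_{TY}$ for every object $Y$. A *model of CBPV* is a cartesian closed $\mathbf{Poset}$-category $\mathcal C$, a coproduct $\mathrm{inl},\mathrm{inr}:1\to2$ (so $2=1+1$) with monotone copairing, and a strong $\mathbf{Poset}$-monad $\mathsf T$ on $\mathcal C$. Value types denote objects: $[\![\mathsf{unit}]\!]=1$, $[\![A_1\times A_2]\!]=[\![A_1]\!]\times[\![A_2]\!]$, $[\![\mathsf{bool}]\!]=2$, and $[\![\mathbf U\underline C]\!]$ is the carrier of $[\![\underline C]\!]$. Computation types denote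 $\mathsf T$-algebras: product algebras for $\Pi$, the exponential algebra $[\![A]\!]\Rightarrow[\![\underline C]\!]$ for $A\to\underline C$, the free algebra on $[\![A]\!]$ for $\mathbf FA$. Contexts denote products, and terms denote morphisms from $[\![\Gamma]\!]$ in the standard way; in particular - $[\![\mathsf{thunk}\,M]\!]=[\![M]\!]$, $[\![\mathsf{force}\,V]\!]=[\![V]\!]$, $[\![\mathsf{return}\,V]\!]=\eta\circ[\![V]\!]$; - $[\![M\,\mathsf{to}\,x.\,N]\!]=[\![N]\!]^\ddagger\circ\langle\mathrm{id},[\![M]\!]\rangle$; - $\lambda$-abstraction is currying, application is uncurrying composed with $\langle\mathrm{id},[\![V]\!]\rangle$, and $\mathsf{if}$ uses $W\times2\cong W+W$. The model is *adequate* with respect to $\preccurlyeq$ if $[\![M]\!]\le[\![M']\!]$ implies $M\lesssim_\Gamma M'$, for all $\Gamma\vdash M,M':\underline C$. **Source language.** Types are $\tau::=\mathsf{unit}\mid\tau_1\times\tau_2\mid\mathsf{bool}\mid\tau\to\tau'$. Expressions, with the usual simple typing, are $$e::=x\mid()\mid(e_1,e_2)\mid\mathsf{fst}\,e\mid\mathsf{snd}\,e\mid\mathsf{true}\mid\mathsf{false}\mid\mathsf{if}\,e_0\,\mathsf{then}\,e_1\,\mathsf{else}\,e_2\mid\lambda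 x{:}\tau.\,e\mid e\,e'.$$ *Call-by-value translation.* $\mathsf{unit}$, $\mathsf{bool}$ and $\times$ are preserved and $(\tau\to\tau')^v=\mathbf U(\tau^v\to\mathbf F\tau'^v)$. Each $x:\tau$ in $\Gamma$ becomes $x:\tau^v$ in $\Gamma^v$, and $\Gamma\vdash e:\tau$ gives $\Gamma^v\vdash e^v:\mathbf F\tau^v$: - variables and constants $c$ become $\mathsf{return}\,c$; - $(e_1,e_2)^v=e_1^v\,\mathsf{to}\,z_1.\,e_2^v\,\mathsf{to}\,z_2.\,\mathsf{return}(z_1,z_2)$; - $(\mathsf{fst}\,e)^v=e^v\,\mathsf{to}\,z.\,\mathsf{match}\,z\,\mathsf{with}\,(z_1,z_2).\mathsf{return}\,z_1$, and $\mathsf{snd}$ likewise with $z_2$; - $(\mathsf{if}\,e_0\,\mathsf{then}\,e_1\,\mathsf{else}\,e_2)^v=e_0^v\,\mathsf{to}\,z.\,\mathsf{if}\,z\,\mathsf{then}\,e_1^v\,\mathsf{else}\,e_2^v$; - $(\lambda x.e)^v=\mathsf{return}\,\mathsf{thunk}\,\lambda x.\,e^v$; - $(e\,e')^v=e^v\,\mathsf{to}\,y.\,e'^v\,\mathsf{to}\,z.\,z{}^{\backprime}\mathsf{force}\,y$.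 *Call-by-name translation.* $\mathsf{unit}^n=\mathbf F\,\mathsf{unit}$, $\mathsf{bool}^n=\mathbf F\,\mathsf{bool}$, $(\tau_1\times\tau_2)^n=\tau_1^n\,\Pi\,\tau_2^n$, $(\tau\to\tau')^n=\mathbf U\tau^n\to\tau'^n$. Each $x:\tau$ in $\Gamma$ becomes $x:\mathbf U\tau^n$ in $\Gamma^n$, and $\Gamma\vdash e:\tau$ gives $\Gamma^n\vdash e^n:\tau^n$: - $x^n=\mathsf{force}\,x$, and constants $c$ become $\mathsf{return}\,c$; - $(e_1,e_2)^n=\lambda\{e_1^n,e_2^n\}$, $(\mathsf{fst}\,e)^n=1{}^{\backprime}e^n$, $(\mathsf{snd}\,e)^n=2{}^{\backprime}e^n$; - $(\mathsf{if}\,e_0\,\mathsf{then}\,e_1\,\mathsf{else}\,e_2)^n=e_0^n\,\mathsf{to}\,z.\,\mathsf{if}\,z\,\mathsf{then}\,e_1^n\,\mathsf{else}\,e_2^n$; - $(\lambda x.e)^n=\lambda x.\,e^n$, and $(e\,e')^n=(\mathsf{thunk}\,e'^n){}^{\backprime}e^n$. **Comparison maps.** For $V:\tau^v$ and $N:\tau^n$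 (in a common CBPV context), define $\hat\varphi_\tau V:\tau^n$ and $\psi_\tau N:\mathbf F\tau^v$ by mutual recursion on $\tau$, with fresh bound variables: - for $\tau\in\{\mathsf{unit},\mathsf{bool}\}$: $\hat\varphi_\tau V=\mathsf{return}\,V$ and $\psi_\tau N=N$; - $\hat\varphi_{\tau_1\times\tau_2}V=\mathsf{match}\,V\,\mathsf{with}\,(z_1,z_2).\,\lambda\{\hat\varphi_{\tau_1}z_1,\hat\varphi_{\tau_2}z_2\}$; - $\psi_{\tau_1\times\tau_2}N=\psi_{\tau_1}(1{}^{\backprime}N)\,\mathsf{to}\,z_1.\,\psi_{\tau_2}(2{}^{\backprime}N)\,\mathsf{to}\,z_2.\,\mathsf{return}(z_1,z_2)$; - $\hat\varphi_{\tau\to\tau'}V=\lambda x{:}\mathbf U\tau^n.\,\psi_\tau(\mathsf{force}\,x)\,\mathsf{to}\,y.\,(y{}^{\backprime}\mathsf{force}\,V)\,\mathsf{to}\,z.\,\hat\varphi_{\tau'}z$; - $\psi_{\tau\to\tau'}N=\mathsf{return}\,\mathsf{thunk}\,\lambda x{:}\tau^v.\,\psi_{\tau'}\bigl((\mathsf{thunk}\,\hat\varphi_\tau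 x){}^{\backprime}N\bigr)$. For $\Gamma=x_1{:}\tau_1,\dots,x_n{:}\tau_n$, let $\hat\varphi_\Gamma$ be the substitution $x_i\mapsto\mathsf{thunk}(\hat\varphi_{\tau_i}x_i)$ from $\Gamma^n$ to $\Gamma^v$. **Theorem.** Let $\preccurlyeq$ be a program relation, and let a model of CBPV be given that is adequate with respect to $\preccurlyeq$ and whose monad $\mathsf T$ is lax idempotent. Then for every source-language typing judgement $\Gamma\vdash e:\tau$, $$e^v\;\lesssim_{\Gamma^v}\;\psi_\tau\bigl(e^n[\hat\varphi_\Gamma]\bigr).$$ -/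

import Mathlib

open CategoryTheory MonoidalCategory CartesianMonoidalCategory

universe v u

/-! ## Order-enriched categories, strong monads and their algebras

Composition is written in diagrammatic order: `f ≫ g` is "first `f`, then `g`". -/

/-- A `Poset`-category: an ordinary category with a partial order on each hom-set, such that
composition is monotone. -/
class PosetCategory (C : Type u) [Category.{v} C] where
  [homOrder : ∀ X Y : C, PartialOrder (X ⟶ Y)]
  comp_mono : ∀ {X Y Z : C} {f f' : X ⟶ Y} {g g' : Y ⟶ Z},
    f ≤ f' → g ≤ g' → f ≫ g ≤ f' ≫ g'

attribute [reducible, instance] PosetCategory.homOrder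

namespace CBPV

section Cartesian

variable {C : Type u} [Category.{v} C] [CartesianMonoidalCategory C]

/-- The canonical morphism `(X₁ × X₂) × X₃ ⟶ (X₁ × X₃) × X₂`. -/
def swapRight (X₁ X₂ X₃ : C) : (X₁ ⊗ X₂) ⊗ X₃ ⟶ (X₁ ⊗ X₃) ⊗ X₂ :=
  lift (lift (fst _ _ ≫ fst _ _) (snd _ _)) (fst _ _ ≫ snd _ _)

variable [MonoidalClosed C]

/-- Currying of the right-hand factor, `C(W × X, Y) → C(W, X ⇒ Y)`. (Mathlib's `curry` is for the
left-hand factor.) -/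
def curryR {W X Y : C} (f : W ⊗ X ⟶ Y) : W ⟶ (ihom X).obj Y :=
  MonoidalClosed.curry (lift (snd X W) (fst X W) ≫ f)

/-- Uncurrying, `C(W, X ⇒ Y) → C(W × X, Y)`. -/
def uncurryR {W X Y : C} (g : W ⟶ (ihom X).obj Y) : W ⊗ X ⟶ Y :=
  lift (snd W X) (fst W X) ≫ MonoidalClosed.uncurry g

theorem uncurryR_curryR {W X Y : C} (f : W ⊗ X ⟶ Y) : uncurryR (curryR f) = f := by
  have h : lift (snd W X) (fst W X) ≫ lift (snd X W) (fst X W) = 𝟙 (W ⊗ X) := by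
    ext <;> simp
  rw [uncurryR, curryR, MonoidalClosed.uncurry_curry, ← Category.assoc, h, Category.id_comp]

theorem curryR_uncurryR {W X Y : C} (g : W ⟶ (ihom X).obj Y) : curryR (uncurryR g) = g := by
  have h : lift (snd X W) (fst X W) ≫ lift (snd W X) (fst W X) = 𝟙 (X ⊗ W) := by
    ext <;> simp
  rw [uncurryR, curryR, ← Category.assoc, h, Category.id_comp, MonoidalClosed.curry_uncurry]

theorem uncurryR_natural {W' W X Y : C} (h : W' ⟶ W) (g : W ⟶ (ihom X).obj Y) :
    uncurryR (h ≫ g) = h ▷ X ≫ uncurryR g := by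
  rw [uncurryR, uncurryR, MonoidalClosed.uncurry_natural_left, ← Category.assoc,
    ← Category.assoc]
  congr 1
  ext <;> simp

theorem curryR_natural {W' W X Y : C} (h : W' ⟶ W) (f : W ⊗ X ⟶ Y) :
    curryR (h ▷ X ≫ f) = h ≫ curryR f := by
  rw [← curryR_uncurryR (h ≫ curryR f), uncurryR_natural, uncurryR_curryR]

end Cartesian

end CBPV

/-- A cartesian closed `Poset`-category: a `Poset`-category whose underlying category is cartesian
closed (has a terminal object `𝟙_ C`, binary products `X ⊗ Y` and exponentials `(ihom X).obj Y`),
such that pairing and currying are monotone. -/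
class CartesianClosedPosetCategory (C : Type u) [Category.{v} C] [CartesianMonoidalCategory C]
    [MonoidalClosed C] extends PosetCategory C where
  lift_mono : ∀ {W X₁ X₂ : C} {f f' : W ⟶ X₁} {g g' : W ⟶ X₂},
    f ≤ f' → g ≤ g' → lift f g ≤ lift f' g'
  curry_mono : ∀ {W X Y : C} {f f' : W ⊗ X ⟶ Y},
    f ≤ f' → CBPV.curryR f ≤ CBPV.curryR f'

namespace CBPV

section Monads

variable (C : Type u) [Category.{v} C] [CartesianMonoidalCategory C] [PosetCategory C]

/-- A strong `Poset`-monad, with the strength baked into the Kleisli extension operator. -/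
structure StrongMonad where
  /-- the object part `X ↦ T X` -/
  obj : C → C
  /-- the unit -/
  unit : ∀ X : C, X ⟶ obj X
  /-- Kleisli extension -/
  ext : ∀ {W X Y : C}, (W ⊗ X ⟶ obj Y) → (W ⊗ obj X ⟶ obj Y)
  ext_mono : ∀ {W X Y : C} {f f' : W ⊗ X ⟶ obj Y}, f ≤ f' → ext f ≤ ext f'
  /-- naturality in the parameter `W` -/
  ext_natural : ∀ {W' W X Y : C} (h : W' ⟶ W) (f : W ⊗ X ⟶ obj Y),
    ext (h ▷ X ≫ f) = h ▷ obj X ≫ ext f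
  unit_ext : ∀ {W X Y : C} (f : W ⊗ X ⟶ obj Y), W ◁ unit X ≫ ext f = f
  ext_unit : ∀ X : C, ext (snd (𝟙_ C) X ≫ unit X) = snd (𝟙_ C) (obj X)
  ext_ext : ∀ {W' W X Y Z : C} (f : W ⊗ X ⟶ obj Y) (g : W' ⊗ Y ⟶ obj Z),
    ext ((α_ W' W X).hom ≫ W' ◁ f ≫ ext g) = (α_ W' W (obj X)).hom ≫ W' ◁ ext f ≫ ext g

variable {C}

namespace StrongMonad

variable (T : StrongMonad C)

/-- Kleisli extension without a parameter (the case `W = 1`). -/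
def ext₁ {X Y : C} (f : X ⟶ T.obj Y) : T.obj X ⟶ T.obj Y :=
  lift (toUnit (T.obj X)) (𝟙 (T.obj X)) ≫ T.ext (snd (𝟙_ C) X ≫ f)

/-- The action of `T` on morphisms. -/
def map {X Y : C} (f : X ⟶ Y) : T.obj X ⟶ T.obj Y := T.ext₁ (f ≫ T.unit Y)

/-- `T` is lax idempotent: `T η_Y ≤ η_{T Y}` for every object `Y`. -/
def LaxIdempotent : Prop := ∀ Y : C, T.map (T.unit Y) ≤ T.unit (T.obj Y)

end StrongMonad

/-- An Eilenberg-Moore algebra of a strong `Poset`-monad, presented by an extension operator. -/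
structure Algebra (T : StrongMonad C) where
  /-- the carrier -/
  carrier : C
  /-- the extension operator -/
  ext : ∀ {W X : C}, (W ⊗ X ⟶ carrier) → (W ⊗ T.obj X ⟶ carrier)
  ext_mono : ∀ {W X : C} {f f' : W ⊗ X ⟶ carrier}, f ≤ f' → ext f ≤ ext f'
  /-- naturality in the parameter `W` -/
  ext_natural : ∀ {W' W X : C} (h : W' ⟶ W) (f : W ⊗ X ⟶ carrier),
    ext (h ▷ X ≫ f) = h ▷ T.obj X ≫ ext f
  unit_ext : ∀ {W X : C} (f : W ⊗ X ⟶ carrier), W ◁ T.unit X ≫ ext f = f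
  ext_ext : ∀ {W' W X Y : C} (f : W ⊗ X ⟶ T.obj Y) (g : W' ⊗ Y ⟶ carrier),
    ext ((α_ W' W X).hom ≫ W' ◁ f ≫ ext g) =
      (α_ W' W (T.obj X)).hom ≫ W' ◁ T.ext f ≫ ext g

/-- The free algebra on `X`. -/
def Algebra.free (T : StrongMonad C) (X : C) : Algebra T where
  carrier := T.obj X
  ext := T.ext
  ext_mono := T.ext_mono
  ext_natural := T.ext_natural
  unit_ext := T.unit_ext
  ext_ext := T.ext_ext

end Monads

section Algebras

variable {C : Type u} [Category.{v} C] [CartesianMonoidalCategory C] [MonoidalClosed C]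
  [CartesianClosedPosetCategory C] {T : StrongMonad C}

theorem uncurryR_mono {W X Y : C} {g g' : W ⟶ (ihom X).obj Y} (h : g ≤ g') :
    uncurryR g ≤ uncurryR g' := by
  have e : ∀ k : W ⟶ (ihom X).obj Y, uncurryR k = k ▷ X ≫ uncurryR (𝟙 _) := fun k => by
    rw [← uncurryR_natural, Category.comp_id]
  rw [e g, e g']
  refine PosetCategory.comp_mono ?_ le_rfl
  have e' : ∀ k : W ⟶ (ihom X).obj Y, k ▷ X = lift (fst W X ≫ k) (snd W X) := fun k => by
    ext <;> simp
  rw [e' g, e' g']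
  exact CartesianClosedPosetCategory.lift_mono (PosetCategory.comp_mono le_rfl h) le_rfl

/-- The product of two algebras. -/
def Algebra.prod (A B : Algebra T) : Algebra T where
  carrier := A.carrier ⊗ B.carrier
  ext f := lift (A.ext (f ≫ fst _ _)) (B.ext (f ≫ snd _ _))
  ext_mono h := CartesianClosedPosetCategory.lift_mono
    (A.ext_mono (PosetCategory.comp_mono h le_rfl))
    (B.ext_mono (PosetCategory.comp_mono h le_rfl))
  ext_natural h f := by
    ext <;> simp [A.ext_natural, B.ext_natural]
  unit_ext f := by
    ext <;> simp [A.unit_ext, B.unit_ext]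
  ext_ext f g := by
    ext <;> simp [A.ext_ext, B.ext_ext]

/-- The exponential algebra `Y ⇒ A` of an object `Y` and an algebra `A`. -/
def Algebra.exp (Y : C) (A : Algebra T) : Algebra T where
  carrier := (ihom Y).obj A.carrier
  ext {W X} f :=
    curryR (swapRight W (T.obj X) Y ≫ A.ext (swapRight W Y X ≫ uncurryR f))
  ext_mono h := CartesianClosedPosetCategory.curry_mono
    (PosetCategory.comp_mono le_rfl
      (A.ext_mono (PosetCategory.comp_mono le_rfl (uncurryR_mono h))))
  ext_natural {W' W X} h f := by
    rw [← curryR_natural, uncurryR_natural]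
    congr 1
    have e : swapRight W' Y X ≫ (h ▷ X) ▷ Y ≫ uncurryR f =
        (h ▷ Y) ▷ X ≫ swapRight W Y X ≫ uncurryR f := by
      simp only [← Category.assoc]
      congr 1
      ext <;> simp [swapRight]
    rw [e, A.ext_natural]
    simp only [← Category.assoc]
    congr 1
    ext <;> simp [swapRight]
  unit_ext {W X} f := by
    rw [← curryR_natural]
    have e : (W ◁ T.unit X) ▷ Y ≫ swapRight W (T.obj X) Y =
        swapRight W X Y ≫ (W ⊗ Y) ◁ T.unit X := by
      ext <;> simp [swapRight]
    have e' : swapRight W X Y ≫ swapRight W Y X = 𝟙 _ := by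
      ext <;> simp [swapRight]
    rw [← Category.assoc, e, Category.assoc, A.unit_ext, ← Category.assoc, e', Category.id_comp,
      curryR_uncurryR]
  ext_ext {W' W X V} f g := by
    rw [← curryR_natural, ← curryR_natural, uncurryR_curryR, ← curryR_natural, ← curryR_natural]
    congr 1
    have e : swapRight (W' ⊗ W) Y X ≫ (α_ W' W X).hom ▷ Y ≫ (W' ◁ f) ▷ Y ≫
          swapRight W' (T.obj V) Y ≫ A.ext (swapRight W' Y V ≫ uncurryR g) =
        swapRight W' W Y ▷ X ≫ (α_ (W' ⊗ Y) W X).hom ≫ (W' ⊗ Y) ◁ f ≫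
          A.ext (swapRight W' Y V ≫ uncurryR g) := by
      simp only [← Category.assoc]
      congr 1
      ext <;> simp [swapRight]
      simp only [← Category.assoc]
      congr 1
      ext <;> simp
    rw [e, A.ext_natural, A.ext_ext]
    simp only [← Category.assoc]
    congr 1
    ext <;> simp [swapRight]
    simp only [← Category.assoc]
    congr 1
    ext <;> simp

end Algebras

/-- The data that, on top of a cartesian closed `Poset`-category `C`, make up a model of CBPV: a
coproduct `2 = 1 + 1` (with monotone copairing) and a strong `Poset`-monad. -/
structure Model (C : Type u) [Category.{v} C] [CartesianMonoidalCategory C] [MonoidalClosed C]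
    [CartesianClosedPosetCategory C] where
  two : C
  inl : 𝟙_ C ⟶ two
  inr : 𝟙_ C ⟶ two
  /-- `two` is a coproduct of the terminal object with itself -/
  isColimit : Limits.IsColimit (Limits.BinaryCofan.mk inl inr)
  copair_mono : ∀ {W : C} {h h' : two ⟶ W}, inl ≫ h ≤ inl ≫ h' → inr ≫ h ≤ inr ≫ h' → h ≤ h'
  T : StrongMonad C

section Branch

variable {C : Type u} [Category.{v} C] [CartesianMonoidalCategory C] [MonoidalClosed C]
  [CartesianClosedPosetCategory C] (𝓜 : Model C)

/-- The copairing `[f, g] : 2 ⟶ W`. -/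
def Model.copair {W : C} (f g : 𝟙_ C ⟶ W) : 𝓜.two ⟶ W :=
  𝓜.isColimit.desc (Limits.BinaryCofan.mk f g)

/-- The composite `[f, g] ∘ dist_W : W × 2 ⟶ Z`, where `dist_W : W × 2 ⟶ W + W` is the
distributivity isomorphism. Since `C` is cartesian closed, it can be formed without choosing a
coproduct `W + W`; `branch_inl`, `branch_inr` and `branch_unique` say that it is the copairing of
`f` and `g` for the coproduct structure `W ⟶ W × 2 ⟵ W`. -/
def Model.branch {W Z : C} (f g : W ⟶ Z) : W ⊗ 𝓜.two ⟶ Z :=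
  W ◁ 𝓜.copair (MonoidalClosed.curry (fst W (𝟙_ C) ≫ f))
    (MonoidalClosed.curry (fst W (𝟙_ C) ≫ g)) ≫ MonoidalClosed.uncurry (𝟙 _)

theorem Model.inl_copair {W : C} (f g : 𝟙_ C ⟶ W) : 𝓜.inl ≫ 𝓜.copair f g = f :=
  𝓜.isColimit.fac (Limits.BinaryCofan.mk f g) ⟨Limits.WalkingPair.left⟩

theorem Model.inr_copair {W : C} (f g : 𝟙_ C ⟶ W) : 𝓜.inr ≫ 𝓜.copair f g = g :=
  𝓜.isColimit.fac (Limits.BinaryCofan.mk f g) ⟨Limits.WalkingPair.right⟩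

theorem Model.branch_inl {W Z : C} (f g : W ⟶ Z) :
    lift (𝟙 W) (toUnit W ≫ 𝓜.inl) ≫ 𝓜.branch f g = f := by
  have e : lift (𝟙 W) (toUnit W ≫ 𝓜.inl) = lift (𝟙 W) (toUnit W) ≫ W ◁ 𝓜.inl := by
    ext <;> simp
  rw [e, branch, Category.assoc, ← MonoidalCategory.whiskerLeft_comp_assoc, inl_copair,
    ← MonoidalClosed.uncurry_natural_left, Category.comp_id, MonoidalClosed.uncurry_curry,
    lift_fst_assoc, Category.id_comp]

theorem Model.branch_inr {W Z : C} (f g : W ⟶ Z) :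
    lift (𝟙 W) (toUnit W ≫ 𝓜.inr) ≫ 𝓜.branch f g = g := by
  have e : lift (𝟙 W) (toUnit W ≫ 𝓜.inr) = lift (𝟙 W) (toUnit W) ≫ W ◁ 𝓜.inr := by
    ext <;> simp
  rw [e, branch, Category.assoc, ← MonoidalCategory.whiskerLeft_comp_assoc, inr_copair,
    ← MonoidalClosed.uncurry_natural_left, Category.comp_id, MonoidalClosed.uncurry_curry,
    lift_fst_assoc, Category.id_comp]

theorem Model.branch_unique {W Z : C} {f g : W ⟶ Z} (h : W ⊗ 𝓜.two ⟶ Z)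
    (h₁ : lift (𝟙 W) (toUnit W ≫ 𝓜.inl) ≫ h = f)
    (h₂ : lift (𝟙 W) (toUnit W ≫ 𝓜.inr) ≫ h = g) : h = 𝓜.branch f g := by
  have key : ∀ (i : 𝟙_ C ⟶ 𝓜.two) (k : W ⊗ 𝓜.two ⟶ Z),
      i ≫ MonoidalClosed.curry k =
        MonoidalClosed.curry (fst W (𝟙_ C) ≫ lift (𝟙 W) (toUnit W ≫ i) ≫ k) := by
    intro i k
    rw [← MonoidalClosed.curry_natural_left, ← Category.assoc (fst _ _)]
    congr 2
    ext
    · simp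
    · simp only [whiskerLeft_snd, Category.assoc, lift_snd]
      rw [← Category.assoc]
      congr 1
      exact toUnit_unique _ _
  apply MonoidalClosed.curry_injective
  refine Limits.BinaryCofan.IsColimit.hom_ext 𝓜.isColimit ?_ ?_
  · change 𝓜.inl ≫ _ = 𝓜.inl ≫ _
    rw [key, key, h₁, branch_inl]
  · change 𝓜.inr ≫ _ = 𝓜.inr ≫ _
    rw [key, key, h₂, branch_inr]

end Branch

/-! ## Syntax of CBPV

Terms are intrinsically typed and use de Bruijn indices (so they are automatically taken up to
renaming of bound variables). Typing contexts list the types of the variables, most recently bound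
variable first. -/

mutual
/-- Value types. -/
inductive VTy : Type
  | unit : VTy
  | prod : VTy → VTy → VTy
  | bool : VTy
  | U : CTy → VTy
/-- Computation types. -/
inductive CTy : Type
  | prod : CTy → CTy → CTy
  | arr : VTy → CTy → CTy
  | F : VTy → CTy
end

/-- `Var Γ a` is the type of variables of type `a` in the context `Γ`. -/
inductive Var {α : Type} : List α → α → Type
  | z {Γ : List α} {a : α} : Var (a :: Γ) a
  | s {Γ : List α} {a b : α} : Var Γ a → Var (b :: Γ) a

/-- The variable of `Γ.map f` corresponding to a variable of `Γ`. -/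
def Var.map {α β : Type} (f : α → β) : {Γ : List α} → {a : α} → Var Γ a → Var (Γ.map f) (f a)
  | _, _, .z => .z
  | _, _, .s x => .s (x.map f)

/-- CBPV typing contexts. -/
abbrev Ctx := List VTy

mutual
/-- Values `Γ ⊢ V : A`. -/
inductive Val : Ctx → VTy → Type
  | var {Γ : Ctx} {A : VTy} : Var Γ A → Val Γ A
  | unit {Γ : Ctx} : Val Γ .unit
  | pair {Γ : Ctx} {A₁ A₂ : VTy} : Val Γ A₁ → Val Γ A₂ → Val Γ (.prod A₁ A₂)
  | true {Γ : Ctx} : Val Γ .bool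
  | false {Γ : Ctx} : Val Γ .bool
  | thunk {Γ : Ctx} {D : CTy} : Comp Γ D → Val Γ (.U D)
/-- Computations `Γ ⊢ M : D`. The term `app V M` applies the function `M` to the argument `V`;
`to M N` is `M to x. N`, where `N` has one extra variable; `matchPair V M` is
`match V with (x₁, x₂). M`, where `M` has the extra variables `x₁ = .s .z` and `x₂ = .z`. -/
inductive Comp : Ctx → CTy → Type
  | pair {Γ : Ctx} {D₁ D₂ : CTy} : Comp Γ D₁ → Comp Γ D₂ → Comp Γ (.prod D₁ D₂)
  | proj₁ {Γ : Ctx} {D₁ D₂ : CTy} : Comp Γ (.prod D₁ D₂) → Comp Γ D₁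
  | proj₂ {Γ : Ctx} {D₁ D₂ : CTy} : Comp Γ (.prod D₁ D₂) → Comp Γ D₂
  | lam {Γ : Ctx} {A : VTy} {D : CTy} : Comp (A :: Γ) D → Comp Γ (.arr A D)
  | app {Γ : Ctx} {A : VTy} {D : CTy} : Val Γ A → Comp Γ (.arr A D) → Comp Γ D
  | ret {Γ : Ctx} {A : VTy} : Val Γ A → Comp Γ (.F A)
  | to {Γ : Ctx} {A : VTy} {D : CTy} : Comp Γ (.F A) → Comp (A :: Γ) D → Comp Γ D
  | matchPair {Γ : Ctx} {A₁ A₂ : VTy} {D : CTy} :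
      Val Γ (.prod A₁ A₂) → Comp (A₂ :: A₁ :: Γ) D → Comp Γ D
  | ite {Γ : Ctx} {D : CTy} : Val Γ .bool → Comp Γ D → Comp Γ D → Comp Γ D
  | force {Γ : Ctx} {D : CTy} : Val Γ (.U D) → Comp Γ D
end

/-! ### Renaming and substitution -/

/-- Renamings: type-preserving maps from the variables of `Γ` to those of `Δ`. -/
abbrev Ren (Γ Δ : Ctx) := ∀ A : VTy, Var Γ A → Var Δ A

/-- Extension of a renaming under a binder. -/
def Ren.lift {Γ Δ : Ctx} (ρ : Ren Γ Δ) (B : VTy) : Ren (B :: Γ) (B :: Δ)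
  | _, .z => .z
  | A, .s x => .s (ρ A x)

mutual
/-- Renaming of variables in a value. -/
def Val.rename : {Γ Δ : Ctx} → {A : VTy} → Ren Γ Δ → Val Γ A → Val Δ A
  | _, _, _, ρ, .var x => .var (ρ _ x)
  | _, _, _, _, .unit => .unit
  | _, _, _, ρ, .pair V W => .pair (V.rename ρ) (W.rename ρ)
  | _, _, _, _, .true => .true
  | _, _, _, _, .false => .false
  | _, _, _, ρ, .thunk M => .thunk (M.rename ρ)
/-- Renaming of variables in a computation. -/
def Comp.rename : {Γ Δ : Ctx} → {D : CTy} → Ren Γ Δ → Comp Γ D → Comp Δ D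
  | _, _, _, ρ, .pair M N => .pair (M.rename ρ) (N.rename ρ)
  | _, _, _, ρ, .proj₁ M => .proj₁ (M.rename ρ)
  | _, _, _, ρ, .proj₂ M => .proj₂ (M.rename ρ)
  | _, _, _, ρ, .lam M => .lam (M.rename (ρ.lift _))
  | _, _, _, ρ, .app V M => .app (V.rename ρ) (M.rename ρ)
  | _, _, _, ρ, .ret V => .ret (V.rename ρ)
  | _, _, _, ρ, .to M N => .to (M.rename ρ) (N.rename (ρ.lift _))
  | _, _, _, ρ, .matchPair V M => .matchPair (V.rename ρ) (M.rename ((ρ.lift _).lift _))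
  | _, _, _, ρ, .ite V M N => .ite (V.rename ρ) (M.rename ρ) (N.rename ρ)
  | _, _, _, ρ, .force V => .force (V.rename ρ)
end

/-- Weakening of a value by one variable. -/
def Val.wk {Γ : Ctx} {A B : VTy} (V : Val Γ A) : Val (B :: Γ) A := V.rename fun _ x => .s x

/-- Weakening of a computation by one variable. -/
def Comp.wk {Γ : Ctx} {D : CTy} {B : VTy} (M : Comp Γ D) : Comp (B :: Γ) D :=
  M.rename fun _ x => .s x

/-- Substitutions: a value over `Δ` for each variable of `Γ`. -/
abbrev Sub (Γ Δ : Ctx) := ∀ A : VTy, Var Γ A → Val Δ A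

/-- Extension of a substitution under a binder. -/
def Sub.lift {Γ Δ : Ctx} (σ : Sub Γ Δ) (B : VTy) : Sub (B :: Γ) (B :: Δ)
  | _, .z => .var .z
  | A, .s x => (σ A x).wk

mutual
/-- Simultaneous (capture-avoiding) substitution in a value. -/
def Val.subst : {Γ Δ : Ctx} → {A : VTy} → Sub Γ Δ → Val Γ A → Val Δ A
  | _, _, _, σ, .var x => σ _ x
  | _, _, _, _, .unit => .unit
  | _, _, _, σ, .pair V W => .pair (V.subst σ) (W.subst σ)
  | _, _, _, _, .true => .true
  | _, _, _, _, .false => .false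
  | _, _, _, σ, .thunk M => .thunk (M.subst σ)
/-- Simultaneous (capture-avoiding) substitution in a computation. -/
def Comp.subst : {Γ Δ : Ctx} → {D : CTy} → Sub Γ Δ → Comp Γ D → Comp Δ D
  | _, _, _, σ, .pair M N => .pair (M.subst σ) (N.subst σ)
  | _, _, _, σ, .proj₁ M => .proj₁ (M.subst σ)
  | _, _, _, σ, .proj₂ M => .proj₂ (M.subst σ)
  | _, _, _, σ, .lam M => .lam (M.subst (σ.lift _))
  | _, _, _, σ, .app V M => .app (V.subst σ) (M.subst σ)
  | _, _, _, σ, .ret V => .ret (V.subst σ)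
  | _, _, _, σ, .to M N => .to (M.subst σ) (N.subst (σ.lift _))
  | _, _, _, σ, .matchPair V M => .matchPair (V.subst σ) (M.subst ((σ.lift _).lift _))
  | _, _, _, σ, .ite V M N => .ite (V.subst σ) (M.subst σ) (N.subst σ)
  | _, _, _, σ, .force V => .force (V.subst σ)
end

/-! ### Program relations and the contextual preorder -/

/-- Ground types: value types that do not contain thunks. -/
inductive VTy.Ground : VTy → Prop
  | unit : Ground .unit
  | prod {G₁ G₂ : VTy} : Ground G₁ → Ground G₂ → Ground (.prod G₁ G₂)
  | bool : Ground .bool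

/-- A program relation: a preorder on the closed computations of type `F G` (the programs), for
each ground type `G`. -/
structure ProgramRelation where
  rel : ∀ {G : VTy}, G.Ground → Comp [] (.F G) → Comp [] (.F G) → Prop
  refl : ∀ {G : VTy} (hG : G.Ground) (M : Comp [] (.F G)), rel hG M M
  trans : ∀ {G : VTy} (hG : G.Ground) {M₁ M₂ M₃ : Comp [] (.F G)},
    rel hG M₁ M₂ → rel hG M₂ M₃ → rel hG M₁ M₃

mutual
/-- Values `Δ ⊢ 𝓔 : A` with a single hole, to be filled with a computation `Γ ⊢ M : D`. -/
inductive VHole (Γ : Ctx) (D : CTy) : Ctx → VTy → Type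
  | pairL {Δ : Ctx} {A₁ A₂ : VTy} : VHole Γ D Δ A₁ → Val Δ A₂ → VHole Γ D Δ (.prod A₁ A₂)
  | pairR {Δ : Ctx} {A₁ A₂ : VTy} : Val Δ A₁ → VHole Γ D Δ A₂ → VHole Γ D Δ (.prod A₁ A₂)
  | thunk {Δ : Ctx} {E : CTy} : CHole Γ D Δ E → VHole Γ D Δ (.U E)
/-- Computation contexts: computations `Δ ⊢ 𝓔 : E` with a single hole, to be filled with a
computation `Γ ⊢ M : D`. The hole may stand in any context `Δ` that contains all the variables
of `Γ`; the injective renaming `ρ` says which variables of `Δ` these are. -/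
inductive CHole (Γ : Ctx) (D : CTy) : Ctx → CTy → Type
  | hole {Δ : Ctx} (ρ : Ren Γ Δ) (hρ : ∀ A, Function.Injective (ρ A)) : CHole Γ D Δ D
  | pairL {Δ : Ctx} {E₁ E₂ : CTy} : CHole Γ D Δ E₁ → Comp Δ E₂ → CHole Γ D Δ (.prod E₁ E₂)
  | pairR {Δ : Ctx} {E₁ E₂ : CTy} : Comp Δ E₁ → CHole Γ D Δ E₂ → CHole Γ D Δ (.prod E₁ E₂)
  | proj₁ {Δ : Ctx} {E₁ E₂ : CTy} : CHole Γ D Δ (.prod E₁ E₂) → CHole Γ D Δ E₁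
  | proj₂ {Δ : Ctx} {E₁ E₂ : CTy} : CHole Γ D Δ (.prod E₁ E₂) → CHole Γ D Δ E₂
  | lam {Δ : Ctx} {A : VTy} {E : CTy} : CHole Γ D (A :: Δ) E → CHole Γ D Δ (.arr A E)
  | appL {Δ : Ctx} {A : VTy} {E : CTy} : VHole Γ D Δ A → Comp Δ (.arr A E) → CHole Γ D Δ E
  | appR {Δ : Ctx} {A : VTy} {E : CTy} : Val Δ A → CHole Γ D Δ (.arr A E) → CHole Γ D Δ E
  | ret {Δ : Ctx} {A : VTy} : VHole Γ D Δ A → CHole Γ D Δ (.F A)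
  | toL {Δ : Ctx} {A : VTy} {E : CTy} : CHole Γ D Δ (.F A) → Comp (A :: Δ) E → CHole Γ D Δ E
  | toR {Δ : Ctx} {A : VTy} {E : CTy} : Comp Δ (.F A) → CHole Γ D (A :: Δ) E → CHole Γ D Δ E
  | matchPairL {Δ : Ctx} {A₁ A₂ : VTy} {E : CTy} :
      VHole Γ D Δ (.prod A₁ A₂) → Comp (A₂ :: A₁ :: Δ) E → CHole Γ D Δ E
  | matchPairR {Δ : Ctx} {A₁ A₂ : VTy} {E : CTy} :
      Val Δ (.prod A₁ A₂) → CHole Γ D (A₂ :: A₁ :: Δ) E → CHole Γ D Δ E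
  | iteC {Δ : Ctx} {E : CTy} : VHole Γ D Δ .bool → Comp Δ E → Comp Δ E → CHole Γ D Δ E
  | iteL {Δ : Ctx} {E : CTy} : Val Δ .bool → CHole Γ D Δ E → Comp Δ E → CHole Γ D Δ E
  | iteR {Δ : Ctx} {E : CTy} : Val Δ .bool → Comp Δ E → CHole Γ D Δ E → CHole Γ D Δ E
  | force {Δ : Ctx} {E : CTy} : VHole Γ D Δ (.U E) → CHole Γ D Δ E
end

mutual
/-- Filling the hole of a value with a hole. -/
def VHole.fill {Γ : Ctx} {D : CTy} : {Δ : Ctx} → {A : VTy} → VHole Γ D Δ A → Comp Γ D → Val Δ A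
  | _, _, .pairL 𝓔 V, M => .pair (𝓔.fill M) V
  | _, _, .pairR V 𝓔, M => .pair V (𝓔.fill M)
  | _, _, .thunk 𝓔, M => .thunk (𝓔.fill M)
/-- The computation `𝓔[M]`. -/
def CHole.fill {Γ : Ctx} {D : CTy} : {Δ : Ctx} → {E : CTy} → CHole Γ D Δ E → Comp Γ D → Comp Δ E
  | _, _, .hole ρ _, M => M.rename ρ
  | _, _, .pairL 𝓔 N, M => .pair (𝓔.fill M) N
  | _, _, .pairR N 𝓔, M => .pair N (𝓔.fill M)
  | _, _, .proj₁ 𝓔, M => .proj₁ (𝓔.fill M)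
  | _, _, .proj₂ 𝓔, M => .proj₂ (𝓔.fill M)
  | _, _, .lam 𝓔, M => .lam (𝓔.fill M)
  | _, _, .appL 𝓔 N, M => .app (𝓔.fill M) N
  | _, _, .appR V 𝓔, M => .app V (𝓔.fill M)
  | _, _, .ret 𝓔, M => .ret (𝓔.fill M)
  | _, _, .toL 𝓔 N, M => .to (𝓔.fill M) N
  | _, _, .toR N 𝓔, M => .to N (𝓔.fill M)
  | _, _, .matchPairL 𝓔 N, M => .matchPair (𝓔.fill M) N
  | _, _, .matchPairR V 𝓔, M => .matchPair V (𝓔.fill M)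
  | _, _, .iteC 𝓔 N₁ N₂, M => .ite (𝓔.fill M) N₁ N₂
  | _, _, .iteL V 𝓔 N, M => .ite V (𝓔.fill M) N
  | _, _, .iteR V N 𝓔, M => .ite V N (𝓔.fill M)
  | _, _, .force 𝓔, M => .force (𝓔.fill M)
end

/-- The contextual preorder `M ≲_Γ M'` induced by a program relation. -/
def CtxLE (R : ProgramRelation) {Γ : Ctx} {D : CTy} (M M' : Comp Γ D) : Prop :=
  ∀ (G : VTy) (hG : G.Ground) (𝓔 : CHole Γ D [] (.F G)), R.rel hG (𝓔.fill M) (𝓔.fill M')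

/-! ## Denotational semantics -/

section Semantics

variable {C : Type u} [Category.{v} C] [CartesianMonoidalCategory C] [MonoidalClosed C]
  [CartesianClosedPosetCategory C] (𝓜 : Model C)

namespace Model

mutual
/-- Auxiliary to `vty`: the interpretation of value types, lifted so that it lives in the same
universe as the interpretation of computation types. -/
noncomputable def vtyAux : VTy → ULift.{v} C
  | .unit => ⟨𝟙_ C⟩
  | .prod A₁ A₂ => ⟨(vtyAux A₁).down ⊗ (vtyAux A₂).down⟩
  | .bool => ⟨𝓜.two⟩
  | .U D => ⟨(cty D).carrier⟩
/-- Interpretation of computation types as algebras. -/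
noncomputable def cty : CTy → Algebra 𝓜.T
  | .prod D₁ D₂ => (cty D₁).prod (cty D₂)
  | .arr A D => (cty D).exp (vtyAux A).down
  | .F A => Algebra.free 𝓜.T (vtyAux A).down
end

/-- Interpretation of value types as objects. -/
noncomputable def vty (A : VTy) : C := (𝓜.vtyAux A).down

/-- Interpretation of typing contexts. -/
noncomputable def ctx : Ctx → C
  | [] => 𝟙_ C
  | A :: Γ => ctx Γ ⊗ 𝓜.vty A

/-- Interpretation of variables, as projections. -/
noncomputable def var : {Γ : Ctx} → {A : VTy} → Var Γ A → (𝓜.ctx Γ ⟶ 𝓜.vty A)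
  | _, _, .z => snd _ _
  | _, _, .s x => fst _ _ ≫ var x

mutual
/-- Interpretation of values. -/
noncomputable def val : {Γ : Ctx} → {A : VTy} → Val Γ A → (𝓜.ctx Γ ⟶ 𝓜.vty A)
  | _, _, .var x => 𝓜.var x
  | Γ, _, .unit => toUnit (𝓜.ctx Γ)
  | _, _, .pair V W => lift (val V) (val W)
  | Γ, _, .true => toUnit (𝓜.ctx Γ) ≫ 𝓜.inl
  | Γ, _, .false => toUnit (𝓜.ctx Γ) ≫ 𝓜.inr
  | _, _, .thunk M => comp M
/-- Interpretation of computations. -/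
noncomputable def comp : {Γ : Ctx} → {D : CTy} → Comp Γ D → (𝓜.ctx Γ ⟶ (𝓜.cty D).carrier)
  | _, _, .pair M N => lift (comp M) (comp N)
  | _, _, .proj₁ (D₁ := D₁) (D₂ := D₂) M =>
      comp M ≫ fst (𝓜.cty D₁).carrier (𝓜.cty D₂).carrier
  | _, _, .proj₂ (D₁ := D₁) (D₂ := D₂) M =>
      comp M ≫ snd (𝓜.cty D₁).carrier (𝓜.cty D₂).carrier
  | _, _, .lam M => curryR (comp M)
  | Γ, _, .app (A := A) (D := D) V M =>
      lift (𝟙 (𝓜.ctx Γ)) (val V) ≫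
        uncurryR (X := 𝓜.vty A) (Y := (𝓜.cty D).carrier) (comp M)
  | _, _, .ret (A := A) V => val V ≫ 𝓜.T.unit (𝓜.vty A)
  | Γ, _, .to (A := A) (D := D) M N =>
      lift (𝟙 (𝓜.ctx Γ)) (comp M) ≫ (𝓜.cty D).ext (W := 𝓜.ctx Γ) (X := 𝓜.vty A) (comp N)
  | Γ, _, .matchPair (A₁ := A₁) (A₂ := A₂) V M =>
      lift (𝟙 (𝓜.ctx Γ)) (val V) ≫ (α_ (𝓜.ctx Γ) (𝓜.vty A₁) (𝓜.vty A₂)).inv ≫ comp M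
  | Γ, _, .ite V M N => lift (𝟙 (𝓜.ctx Γ)) (val V) ≫ 𝓜.branch (comp M) (comp N)
  | _, _, .force V => val V
end

/-- The model is adequate with respect to the program relation `R`. -/
def Adequate (R : ProgramRelation) : Prop :=
  ∀ {Γ : Ctx} {D : CTy} (M M' : Comp Γ D), 𝓜.comp M ≤ 𝓜.comp M' → CtxLE R M M'

end Model

end Semantics

/-! ## The source language and its two translations into CBPV -/

/-- Source-language types. -/
inductive Ty : Type
  | unit : Ty
  | prod : Ty → Ty → Ty
  | bool : Ty
  | arr : Ty → Ty → Ty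

/-- Well-typed source-language expressions `Γ ⊢ e : τ`. -/
inductive Expr : List Ty → Ty → Type
  | var {Γ : List Ty} {τ : Ty} : Var Γ τ → Expr Γ τ
  | unit {Γ : List Ty} : Expr Γ .unit
  | pair {Γ : List Ty} {τ₁ τ₂ : Ty} : Expr Γ τ₁ → Expr Γ τ₂ → Expr Γ (.prod τ₁ τ₂)
  | fst {Γ : List Ty} {τ₁ τ₂ : Ty} : Expr Γ (.prod τ₁ τ₂) → Expr Γ τ₁
  | snd {Γ : List Ty} {τ₁ τ₂ : Ty} : Expr Γ (.prod τ₁ τ₂) → Expr Γ τ₂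
  | true {Γ : List Ty} : Expr Γ .bool
  | false {Γ : List Ty} : Expr Γ .bool
  | ite {Γ : List Ty} {τ : Ty} : Expr Γ .bool → Expr Γ τ → Expr Γ τ → Expr Γ τ
  | lam {Γ : List Ty} {τ τ' : Ty} : Expr (τ :: Γ) τ' → Expr Γ (.arr τ τ')
  | app {Γ : List Ty} {τ τ' : Ty} : Expr Γ (.arr τ τ') → Expr Γ τ → Expr Γ τ'

/-- Call-by-value translation of types. -/
def Ty.cbv : Ty → VTy
  | .unit => .unit
  | .prod τ₁ τ₂ => .prod τ₁.cbv τ₂.cbv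
  | .bool => .bool
  | .arr τ τ' => .U (.arr τ.cbv (.F τ'.cbv))

/-- Call-by-name translation of types. -/
def Ty.cbn : Ty → CTy
  | .unit => .F .unit
  | .prod τ₁ τ₂ => .prod τ₁.cbn τ₂.cbn
  | .bool => .F .bool
  | .arr τ τ' => .arr (.U τ.cbn) τ'.cbn

/-- Call-by-value translation of typing contexts. -/
abbrev cbvCtx (Γ : List Ty) : Ctx := Γ.map Ty.cbv

/-- Call-by-name translation of typing contexts. -/
abbrev cbnCtx (Γ : List Ty) : Ctx := Γ.map fun τ => VTy.U τ.cbn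

/-- Call-by-value translation `e ↦ eᵛ` of expressions. -/
def Expr.cbv : {Γ : List Ty} → {τ : Ty} → Expr Γ τ → Comp (cbvCtx Γ) (.F τ.cbv)
  | _, _, .var x => .ret (.var (x.map Ty.cbv))
  | _, _, .unit => .ret .unit
  | _, _, .pair e₁ e₂ =>
      .to e₁.cbv (.to e₂.cbv.wk (.ret (.pair (.var (.s .z)) (.var .z))))
  | _, _, .fst e => .to e.cbv (.matchPair (.var .z) (.ret (.var (.s .z))))
  | _, _, .snd e => .to e.cbv (.matchPair (.var .z) (.ret (.var .z)))
  | _, _, .true => .ret .true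
  | _, _, .false => .ret .false
  | _, _, .ite e₀ e₁ e₂ => .to e₀.cbv (.ite (.var .z) e₁.cbv.wk e₂.cbv.wk)
  | _, _, .lam e => .ret (.thunk (.lam e.cbv))
  | _, _, .app e e' => .to e.cbv (.to e'.cbv.wk (.app (.var .z) (.force (.var (.s .z)))))

/-- Call-by-name translation `e ↦ eⁿ` of expressions. -/
def Expr.cbn : {Γ : List Ty} → {τ : Ty} → Expr Γ τ → Comp (cbnCtx Γ) τ.cbn
  | _, _, .var x => .force (.var (x.map fun τ => VTy.U τ.cbn))
  | _, _, .unit => .ret .unit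
  | _, _, .pair e₁ e₂ => .pair e₁.cbn e₂.cbn
  | _, _, .fst e => .proj₁ e.cbn
  | _, _, .snd e => .proj₂ e.cbn
  | _, _, .true => .ret .true
  | _, _, .false => .ret .false
  | _, _, .ite e₀ e₁ e₂ => .to e₀.cbn (.ite (.var .z) e₁.cbn.wk e₂.cbn.wk)
  | _, _, .lam e => .lam e.cbn
  | _, _, .app e e' => .app (.thunk e'.cbn) e.cbn

/-! ## The maps between call-by-value and call-by-name -/

mutual
/-- The map `φ̂_τ` from call-by-value values to call-by-name computations. -/
def toNameHat : (τ : Ty) → {Γ : Ctx} → Val Γ τ.cbv → Comp Γ τ.cbn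
  | .unit, _, V => .ret V
  | .prod τ₁ τ₂, _, V =>
      .matchPair V (.pair (toNameHat τ₁ (.var (.s .z))) (toNameHat τ₂ (.var .z)))
  | .bool, _, V => .ret V
  | .arr τ τ', _, V =>
      .lam (.to (toValue τ (.force (.var .z)))
        (.to (.app (.var .z) (.force V.wk.wk)) (toNameHat τ' (.var .z))))
/-- The map `ψ_τ` from call-by-name computations to call-by-value computations. -/
def toValue : (τ : Ty) → {Γ : Ctx} → Comp Γ τ.cbn → Comp Γ (.F τ.cbv)
  | .unit, _, N => N
  | .prod τ₁ τ₂, _, N =>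
      .to (toValue τ₁ (.proj₁ N))
        (.to (toValue τ₂ (.proj₂ N.wk)) (.ret (.pair (.var (.s .z)) (.var .z))))
  | .bool, _, N => N
  | .arr τ τ', _, N =>
      .ret (.thunk (.lam (toValue τ' (.app (.thunk (toNameHat τ (.var .z))) N.wk))))
end

/-- The substitution `φ̂_Γ`, which sends each variable `x : τ` of `Γ` to `thunk (φ̂_τ x)`. -/
def toNameSub : (Γ : List Ty) → Sub (cbnCtx Γ) (cbvCtx Γ)
  | [], _, x => nomatch x
  | τ :: _, _, .z => .thunk (toNameHat τ (.var .z))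
  | _ :: Γ, A, .s x => (toNameSub Γ A x).wk

end CBPV

-- By adequacy it is enough to prove an inequality between denotations, namely that `e.cbv` lies
-- below `e.cbn` precomposed with the interpretation `nameSubMap` of φ̂_Γ and postcomposed with that
-- of ψ_τ.
--
-- Lax idempotence enters through one fact: if `Z` carries an algebra with structure map a : TZ → Z,
-- then id ≤ η_Z ∘ a (`AlgebraOn.le_bind_snd_unit`). Consequently every morphism g between carriers
-- of algebras is a lax homomorphism, "m to x. g(n) ≤ g(m to x. n)" (`AlgebraOn.bind_lift_le`). In
-- particular, effects whose result is discarded can only make a computation smaller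
-- (`AlgebraOn.bind_fst_le`).
--
-- These facts make the comparison maps adjoint at every type. With X the value object and Z the
-- carrier of the call-by-name algebra, the extension of φ : X → Z is left adjoint to ψ : Z → TX.
-- `IsGaloisPair` records η ≤ ψ ∘ φ and the counit inequality; the rest of the unit law follows by
-- laxity of ψ. Base types give the pair (η, id), and the property is preserved by products and
-- function spaces (`IsGaloisPair.prod`, `IsGaloisPair.arrow`).
--
-- The inequality `Model.comp_cbv_le` then follows by induction on `e`. Variables use the unit,
-- application uses the counit and laxity, conditionals use laxity of ψ, and projections use
-- discarding. Constants, pairs and abstractions require only monotonicity and equations. Lemmas on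
-- renaming and substitution connect the syntactic maps with their denotations.

namespace CBPV

-- Cartesian closed calculations: matching, application, order

section Cartesian

variable {C : Type u} [Category.{v} C] [CartesianMonoidalCategory C]

/-- Stability of pair matching under a change of context, for the `matchPair` clauses of renaming
and substitution. -/
theorem comp_split {W' W X₁ X₂ Z : C} (h : W' ⟶ W) (x : W ⟶ X₁ ⊗ X₂)
    (f : (W ⊗ X₁) ⊗ X₂ ⟶ Z) :
    h ≫ lift (𝟙 W) x ≫ (α_ W X₁ X₂).inv ≫ f =
      lift (𝟙 W') (h ≫ x) ≫ (α_ W' X₁ X₂).inv ≫ (h ▷ X₁) ▷ X₂ ≫ f := by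
  simp only [← Category.assoc]
  congr 1
  ext <;> simp

theorem lift_id_assocInv_lift {W X₁ X₂ Z₁ Z₂ : C} (v : W ⟶ X₁ ⊗ X₂) (f : X₁ ⟶ Z₁)
    (g : X₂ ⟶ Z₂) :
    lift (𝟙 W) v ≫ (α_ W X₁ X₂).inv ≫ lift ((fst _ _ ≫ snd _ _) ≫ f) (snd _ _ ≫ g) =
      v ≫ lift (fst X₁ X₂ ≫ f) (snd X₁ X₂ ≫ g) := by
  ext <;> simp

theorem comp_toUnit_comp {W V X : C} (s : W ⟶ V) (k : 𝟙_ C ⟶ X) :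
    s ≫ (toUnit V ≫ k) ≫ 𝟙 X = toUnit W ≫ k := by
  rw [Category.comp_id, comp_toUnit_assoc]

end Cartesian

section Application

variable {C : Type u} [Category.{v} C] [CartesianMonoidalCategory C] [MonoidalClosed C]

/-- Application of a function to an argument. -/
def applyTo {W X Y : C} (x : W ⟶ X) (f : W ⟶ (ihom X).obj Y) : W ⟶ Y :=
  lift (𝟙 W) x ≫ uncurryR f

theorem comp_applyTo {W' W X Y : C} (h : W' ⟶ W) (x : W ⟶ X) (f : W ⟶ (ihom X).obj Y) :
    h ≫ applyTo x f = applyTo (h ≫ x) (h ≫ f) := by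
  rw [applyTo, applyTo, uncurryR_natural, ← Category.assoc, ← Category.assoc]
  congr 1
  ext <;> simp

theorem applyTo_curryR {W X Y : C} (x : W ⟶ X) (f : W ⊗ X ⟶ Y) :
    applyTo x (curryR f) = lift (𝟙 W) x ≫ f := by
  rw [applyTo, uncurryR_curryR]

theorem applyTo_snd {W X Y : C} (f : W ⟶ (ihom X).obj Y) :
    applyTo (snd W X) (fst W X ≫ f) = uncurryR f := by
  have e : lift (𝟙 (W ⊗ X)) (snd W X) ≫ fst W X ▷ X = 𝟙 _ := by
    ext <;> simp
  rw [applyTo, uncurryR_natural, ← Category.assoc, e, Category.id_comp]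

theorem curryR_applyTo {W X Y : C} (f : W ⟶ (ihom X).obj Y) :
    curryR (applyTo (snd W X) (fst W X ≫ f)) = f := by
  rw [applyTo_snd, curryR_uncurryR]

end Application

section Order

variable {C : Type u} [Category.{v} C] [CartesianMonoidalCategory C] [MonoidalClosed C]
  [CartesianClosedPosetCategory C]

theorem comp_le_comp {X Y Z : C} {f f' : X ⟶ Y} {g g' : Y ⟶ Z} (hf : f ≤ f') (hg : g ≤ g') :
    f ≫ g ≤ f' ≫ g' :=
  PosetCategory.comp_mono hf hg

theorem comp_le_comp_left {X Y Z : C} (f : X ⟶ Y) {g g' : Y ⟶ Z} (hg : g ≤ g') :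
    f ≫ g ≤ f ≫ g' :=
  comp_le_comp le_rfl hg

theorem comp_le_comp_right {X Y Z : C} {f f' : X ⟶ Y} (hf : f ≤ f') (g : Y ⟶ Z) :
    f ≫ g ≤ f' ≫ g :=
  comp_le_comp hf le_rfl

theorem lift_le_lift {W X Y : C} {f f' : W ⟶ X} {g g' : W ⟶ Y} (hf : f ≤ f') (hg : g ≤ g') :
    lift f g ≤ lift f' g' :=
  CartesianClosedPosetCategory.lift_mono hf hg

theorem curryR_le_curryR {W X Y : C} {f f' : W ⊗ X ⟶ Y} (h : f ≤ f') : curryR f ≤ curryR f' :=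
  CartesianClosedPosetCategory.curry_mono h

theorem applyTo_mono {W X Y : C} {x x' : W ⟶ X} {f f' : W ⟶ (ihom X).obj Y} (hx : x ≤ x')
    (hf : f ≤ f') : applyTo x f ≤ applyTo x' f' :=
  comp_le_comp (lift_le_lift le_rfl hx) (uncurryR_mono hf)

/-- Functions are compared at a generic argument: currying is monotone and, by the η-law, recovers
the function. -/
theorem le_of_applyTo_le {W X Y : C} {f f' : W ⟶ (ihom X).obj Y}
    (h : applyTo (snd W X) (fst W X ≫ f) ≤ applyTo (snd W X) (fst W X ≫ f')) : f ≤ f' := by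
  have h' := curryR_le_curryR h
  rwa [curryR_applyTo, curryR_applyTo] at h'

end Order

-- Sequencing in algebras and lax homomorphisms

section AlgebraOn

variable {C : Type u} [Category.{v} C] [CartesianMonoidalCategory C] [MonoidalClosed C]
  [CartesianClosedPosetCategory C]

/-- An algebra structure on a given object `Z`. -/
structure AlgebraOn (T : StrongMonad C) (Z : C) where
  /-- the extension operator -/
  ext : ∀ {W X : C}, (W ⊗ X ⟶ Z) → (W ⊗ T.obj X ⟶ Z)
  ext_mono : ∀ {W X : C} {f f' : W ⊗ X ⟶ Z}, f ≤ f' → ext f ≤ ext f'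
  ext_natural : ∀ {W' W X : C} (h : W' ⟶ W) (f : W ⊗ X ⟶ Z),
    ext (h ▷ X ≫ f) = h ▷ T.obj X ≫ ext f
  unit_ext : ∀ {W X : C} (f : W ⊗ X ⟶ Z), W ◁ T.unit X ≫ ext f = f
  ext_ext : ∀ {W' W X Y : C} (f : W ⊗ X ⟶ T.obj Y) (g : W' ⊗ Y ⟶ Z),
    ext ((α_ W' W X).hom ≫ W' ◁ f ≫ ext g) =
      (α_ W' W (T.obj X)).hom ≫ W' ◁ T.ext f ≫ ext g

variable {T : StrongMonad C}

/-- The algebra structure on the carrier of an algebra. -/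
def Algebra.on (A : Algebra T) : AlgebraOn T A.carrier where
  ext := A.ext
  ext_mono := A.ext_mono
  ext_natural := A.ext_natural
  unit_ext := A.unit_ext
  ext_ext := A.ext_ext

namespace AlgebraOn

variable {Z Z' : C}

/-- The algebra with a given algebra structure. -/
def toAlgebra (A : AlgebraOn T Z) : Algebra T where
  carrier := Z
  ext := A.ext
  ext_mono := A.ext_mono
  ext_natural := A.ext_natural
  unit_ext := A.unit_ext
  ext_ext := A.ext_ext

/-- The free algebra structure. -/
def free (T : StrongMonad C) (X : C) : AlgebraOn T (T.obj X) := (Algebra.free T X).on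

/-- The product of two algebra structures. -/
def prod (A : AlgebraOn T Z) (B : AlgebraOn T Z') : AlgebraOn T (Z ⊗ Z') :=
  (A.toAlgebra.prod B.toAlgebra).on

/-- The exponential of an algebra structure. -/
def exp (Y : C) (A : AlgebraOn T Z) : AlgebraOn T ((ihom Y).obj Z) :=
  (A.toAlgebra.exp Y).on

/-- Sequencing of a computation `m` with a continuation `n` into an algebra. -/
def bind (A : AlgebraOn T Z) {W X : C} (m : W ⟶ T.obj X) (n : W ⊗ X ⟶ Z) : W ⟶ Z :=
  lift (𝟙 W) m ≫ A.ext n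

end AlgebraOn

/-- Sequencing in a free algebra. -/
abbrev StrongMonad.bind (T : StrongMonad C) {W X Y : C} (m : W ⟶ T.obj X)
    (n : W ⊗ X ⟶ T.obj Y) : W ⟶ T.obj Y :=
  (AlgebraOn.free T Y).bind m n

namespace AlgebraOn

variable {Z : C} (A : AlgebraOn T Z)

theorem bind_mono {W X : C} {m m' : W ⟶ T.obj X} {n n' : W ⊗ X ⟶ Z}
    (hm : m ≤ m') (hn : n ≤ n') : A.bind m n ≤ A.bind m' n' :=
  comp_le_comp (lift_le_lift le_rfl hm) (A.ext_mono hn)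

theorem comp_bind {W' W X : C} (h : W' ⟶ W) (m : W ⟶ T.obj X) (n : W ⊗ X ⟶ Z) :
    h ≫ A.bind m n = A.bind (h ≫ m) (h ▷ X ≫ n) := by
  rw [bind, bind, A.ext_natural, ← Category.assoc, ← Category.assoc]
  congr 1
  ext <;> simp

theorem bind_unit {W X : C} (v : W ⟶ X) (n : W ⊗ X ⟶ Z) :
    A.bind (v ≫ T.unit X) n = lift (𝟙 W) v ≫ n := by
  have e : lift (𝟙 W) (v ≫ T.unit X) = lift (𝟙 W) v ≫ W ◁ T.unit X := by
    ext <;> simp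
  rw [bind, e, Category.assoc, A.unit_ext]

/-- The law `ext_ext` gives the two continuations independent parameters `W'` and `W`. Here they
share one context, so the law is used with `W' = W` and pulled back along the diagonal of `W`. -/
theorem bind_assoc {W X Y : C} (m : W ⟶ T.obj X) (n : W ⊗ X ⟶ T.obj Y) (p : W ⊗ Y ⟶ Z) :
    A.bind (T.bind m n) p = A.bind m (A.bind n (fst W X ▷ Y ≫ p)) := by
  have e₁ : lift (𝟙 (W ⊗ X)) n ≫ fst W X ▷ T.obj Y =
      lift (𝟙 W) (𝟙 W) ▷ X ≫ (α_ W W X).hom ≫ W ◁ n := by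
    ext
    · simp
    · simp only [Category.assoc, whiskerRight_snd, lift_snd, whiskerLeft_snd]
      rw [← Category.assoc, ← Category.assoc]
      conv_lhs => rw [← Category.id_comp n]
      congr 1
      ext <;> simp
  have e₂ : A.bind n (fst W X ▷ Y ≫ p) =
      lift (𝟙 W) (𝟙 W) ▷ X ≫ (α_ W W X).hom ≫ W ◁ n ≫ A.ext p := by
    rw [bind, A.ext_natural, ← Category.assoc, e₁, Category.assoc, Category.assoc]
  have e₃ : lift (𝟙 W) (T.bind m n) =
      lift (𝟙 W) m ≫ lift (𝟙 W) (𝟙 W) ▷ T.obj X ≫ (α_ W W (T.obj X)).hom ≫ W ◁ T.ext n := by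
    ext
    · simp
    · simp only [Category.assoc, lift_snd, whiskerLeft_snd]
      simp only [← Category.assoc]
      change lift (𝟙 W) m ≫ T.ext n = _
      congr 1
      ext <;> simp
  rw [e₂, bind, bind, A.ext_natural, A.ext_ext, e₃]
  simp only [Category.assoc]

end AlgebraOn

/-- Naturality of extension along `W ⟶ 1`; it expresses `T.map`, and thereby lax idempotence,
through `bind`. -/
theorem StrongMonad.comp_ext₁ (T : StrongMonad C) {X Y : C} (f : X ⟶ T.obj Y) {W : C}
    (m : W ⟶ T.obj X) : m ≫ T.ext₁ f = T.bind m (snd W X ≫ f) := by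
  have e : snd W X ≫ f = toUnit W ▷ X ≫ snd (𝟙_ C) X ≫ f := by simp
  have e' : m ≫ lift (toUnit (T.obj X)) (𝟙 (T.obj X)) = lift (𝟙 W) m ≫ toUnit W ▷ T.obj X := by
    ext
    simp
  rw [StrongMonad.ext₁, ← Category.assoc, e', e, Category.assoc, ← T.ext_natural]
  rfl

theorem StrongMonad.bind_snd_unit (T : StrongMonad C) {W X : C} (m : W ⟶ T.obj X) :
    T.bind m (snd W X ≫ T.unit X) = m := by
  rw [← StrongMonad.comp_ext₁, StrongMonad.ext₁, T.ext_unit]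
  simp

namespace AlgebraOn

variable {Z Z' : C}

theorem bind_comp_unit (A : AlgebraOn T Z) {W X Y : C} (m : W ⟶ T.obj X) (n : W ⊗ X ⟶ Y)
    (p : W ⊗ Y ⟶ Z) :
    A.bind (T.bind m (n ≫ T.unit Y)) p = A.bind m (lift (fst W X) n ≫ p) := by
  rw [bind_assoc, bind_unit, ← Category.assoc]
  congr 2
  ext <;> simp

/-- With a the structure map of `A`, this is id ≤ η_Z ∘ a. Extend both sides of Tη_Z ≤ η_{TZ} along
η_Z ∘ a : TZ → TZ. The left side collapses to the identity because a ∘ η_Z = id, and the right side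
becomes η_Z ∘ a. -/
theorem le_bind_snd_unit (hT : T.LaxIdempotent) (A : AlgebraOn T Z) {W : C} (t : W ⟶ T.obj Z) :
    t ≤ A.bind t (snd W Z) ≫ T.unit Z := by
  have h₁ := comp_le_comp_left t (hT Z)
  rw [StrongMonad.map, StrongMonad.comp_ext₁, ← Category.assoc] at h₁
  have h₂ := (free T Z).bind_mono h₁ (le_refl (A.bind (snd W _) (snd _ _) ≫ T.unit Z))
  have h₃ : lift (fst W Z) (snd W Z ≫ T.unit Z) ≫
      A.bind (snd W (T.obj Z)) (snd _ _) ≫ T.unit Z = snd W Z ≫ T.unit Z := by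
    rw [← Category.assoc, comp_bind, lift_snd, bind_unit]
    simp
  have h₄ : lift (𝟙 W) t ≫ A.bind (snd W (T.obj Z)) (snd _ _) = A.bind t (snd W Z) := by
    rw [comp_bind]
    simp
  rw [bind_comp_unit, bind_unit, h₃, ← Category.assoc, h₄] at h₂
  exact (T.bind_snd_unit t).symm.le.trans h₂

/-- For a lax idempotent monad, every map between algebras is a lax homomorphism. -/
theorem bind_lift_le (hT : T.LaxIdempotent) (A : AlgebraOn T Z) (B : AlgebraOn T Z') {W X : C}
    (m : W ⟶ T.obj X) (n : W ⊗ X ⟶ Z) (g : W ⊗ Z ⟶ Z') :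
    B.bind m (lift (fst W X) n ≫ g) ≤ lift (𝟙 W) (A.bind m n) ≫ g := by
  -- The computation "m to x. return n" lies below "return (m to x. n)"; continuing both with `g`
  -- gives the claim.
  have h := A.le_bind_snd_unit hT (T.bind m (n ≫ T.unit Z))
  rw [bind_comp_unit, lift_snd] at h
  have h' := B.bind_mono h (le_refl g)
  rwa [bind_comp_unit, bind_unit] at h'

theorem bind_comp_le (hT : T.LaxIdempotent) (A : AlgebraOn T Z) (B : AlgebraOn T Z') {W X : C}
    (m : W ⟶ T.obj X) (n : W ⊗ X ⟶ Z) (g : Z ⟶ Z') :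
    B.bind m (n ≫ g) ≤ A.bind m n ≫ g := by
  simpa using bind_lift_le hT A B m n (snd _ _ ≫ g)

/-- A continuation that ignores the result of `m` is a constant map out of any algebra, here T1, and
constant maps are lax homomorphisms too. -/
theorem bind_fst_le (hT : T.LaxIdempotent) (A : AlgebraOn T Z) {W X : C} (m : W ⟶ T.obj X)
    (k : W ⟶ Z) : A.bind m (fst W X ≫ k) ≤ k := by
  simpa using bind_lift_le hT (free T (𝟙_ C)) A m (toUnit _ ≫ T.unit (𝟙_ C)) (fst _ _ ≫ k)

theorem prod_bind (A : AlgebraOn T Z) (B : AlgebraOn T Z') {W X : C} (m : W ⟶ T.obj X)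
    (n : W ⊗ X ⟶ Z ⊗ Z') :
    (A.prod B).bind m n = lift (A.bind m (n ≫ fst _ _)) (B.bind m (n ≫ snd _ _)) := by
  rw [bind, bind, bind, ← comp_lift]
  rfl

end AlgebraOn

end AlgebraOn

-- Galois pairs at base types, products and function spaces

section Galois

variable {C : Type u} [Category.{v} C] [CartesianMonoidalCategory C] [MonoidalClosed C]
  [CartesianClosedPosetCategory C] {T : StrongMonad C}

/-- A pair of maps between an object `X` of call-by-value values and an algebra `A` of call-by-name
computations that induces an adjunction between call-by-value and call-by-name computations. -/
structure IsGaloisPair {Z : C} (A : AlgebraOn T Z) {X : C} (φ : X ⟶ Z) (ψ : Z ⟶ T.obj X) :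
    Prop where
  unit_le : T.unit X ≤ φ ≫ ψ
  bind_le : ∀ {W : C} (n : W ⟶ Z), A.bind (n ≫ ψ) (snd W X ≫ φ) ≤ n

theorem isGaloisPair_free (T : StrongMonad C) (X : C) :
    IsGaloisPair (AlgebraOn.free T X) (T.unit X) (𝟙 (T.obj X)) where
  unit_le := (Category.comp_id _).symm.le
  bind_le n := by
    rw [Category.comp_id]
    exact (T.bind_snd_unit n).le

/-- The pairing of two computations, evaluated from left to right. -/
def StrongMonad.seqPair (T : StrongMonad C) {W X Y : C} (m : W ⟶ T.obj X) (n : W ⟶ T.obj Y) :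
    W ⟶ T.obj (X ⊗ Y) :=
  T.bind m (T.bind (fst W X ≫ n) (lift (fst _ _ ≫ snd _ _) (snd _ _) ≫ T.unit (X ⊗ Y)))

theorem comp_seqPair {W' W X Y : C} (h : W' ⟶ W) (m : W ⟶ T.obj X) (n : W ⟶ T.obj Y) :
    h ≫ T.seqPair m n = T.seqPair (h ≫ m) (h ≫ n) := by
  rw [StrongMonad.seqPair, StrongMonad.seqPair, AlgebraOn.comp_bind, AlgebraOn.comp_bind,
    ← Category.assoc (_ ▷ _ ▷ _)]
  simp

theorem seqPair_mono {W X Y : C} {m m' : W ⟶ T.obj X} {n n' : W ⟶ T.obj Y} (hm : m ≤ m')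
    (hn : n ≤ n') : T.seqPair m n ≤ T.seqPair m' n' :=
  AlgebraOn.bind_mono _ hm (AlgebraOn.bind_mono _ (comp_le_comp_left _ hn) le_rfl)

theorem seqPair_unit {W X Y : C} (x : W ⟶ X) (y : W ⟶ Y) :
    T.seqPair (x ≫ T.unit X) (y ≫ T.unit Y) = lift x y ≫ T.unit (X ⊗ Y) := by
  rw [StrongMonad.seqPair, StrongMonad.bind, AlgebraOn.bind_unit, ← Category.assoc (fst _ _),
    StrongMonad.bind, AlgebraOn.bind_unit]
  simp only [← Category.assoc]
  congr 1
  ext <;> simp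

theorem bind_seqPair {Z : C} (A : AlgebraOn T Z) {W X Y : C} (m : W ⟶ T.obj X) (n : W ⟶ T.obj Y)
    (p : W ⊗ (X ⊗ Y) ⟶ Z) :
    A.bind (T.seqPair m n) p = A.bind m (A.bind (fst W X ≫ n) ((α_ W X Y).hom ≫ p)) := by
  rw [StrongMonad.seqPair, AlgebraOn.bind_assoc, AlgebraOn.bind_comp_unit]
  congr 2
  simp only [← Category.assoc]
  congr 1
  ext <;> simp

/-- After reassociation the result of `n` is unused, so `n` can be discarded. -/
theorem bind_seqPair_fst_le (hT : T.LaxIdempotent) {Z : C} (A : AlgebraOn T Z) {W X Y : C}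
    (m : W ⟶ T.obj X) (n : W ⟶ T.obj Y) (k : W ⊗ X ⟶ Z) :
    A.bind (T.seqPair m n) (W ◁ fst X Y ≫ k) ≤ A.bind m k := by
  have e : (α_ W X Y).hom ≫ W ◁ fst X Y ≫ k = fst (W ⊗ X) Y ≫ k := by
    rw [← Category.assoc]
    congr 1
    ext <;> simp
  rw [bind_seqPair, e]
  exact A.bind_mono le_rfl (A.bind_fst_le hT _ k)

theorem bind_seqPair_snd_le (hT : T.LaxIdempotent) {Z : C} (A : AlgebraOn T Z) {W X Y : C}
    (m : W ⟶ T.obj X) (n : W ⟶ T.obj Y) (k : W ⊗ Y ⟶ Z) :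
    A.bind (T.seqPair m n) (W ◁ snd X Y ≫ k) ≤ A.bind n k := by
  have e : (α_ W X Y).hom ≫ W ◁ snd X Y ≫ k = fst W X ▷ Y ≫ k := by
    rw [← Category.assoc]
    congr 1
    ext <;> simp
  rw [bind_seqPair, e, ← AlgebraOn.comp_bind]
  exact A.bind_fst_le hT _ _

/-- The unit inequality needs only monotonicity, since pairing two returns is a return. For the
counit, each component of the result uses one half of the sequenced pair; discarding the other half
leaves the counit of a factor. -/
theorem IsGaloisPair.prod (hT : T.LaxIdempotent) {Z Z' : C} {A : AlgebraOn T Z}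
    {B : AlgebraOn T Z'} {X Y : C} {φ : X ⟶ Z} {ψ : Z ⟶ T.obj X} {φ' : Y ⟶ Z'}
    {ψ' : Z' ⟶ T.obj Y} (h : IsGaloisPair A φ ψ) (h' : IsGaloisPair B φ' ψ') :
    IsGaloisPair (A.prod B) (lift (fst X Y ≫ φ) (snd X Y ≫ φ'))
      (T.seqPair (fst Z Z' ≫ ψ) (snd Z Z' ≫ ψ')) where
  unit_le := by
    rw [comp_seqPair, lift_fst_assoc, lift_snd_assoc, Category.assoc, Category.assoc]
    refine le_trans (Eq.le ?_) (seqPair_mono (comp_le_comp_left _ h.unit_le)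
      (comp_le_comp_left _ h'.unit_le))
    rw [seqPair_unit]
    simp
  bind_le {W} n := by
    have e : n = lift (n ≫ fst Z Z') (n ≫ snd Z Z') := by simp
    rw [AlgebraOn.prod_bind, comp_seqPair, ← Category.assoc, ← Category.assoc]
    conv_rhs => rw [e]
    refine lift_le_lift (le_trans (Eq.le ?_) ((bind_seqPair_fst_le hT A
      ((n ≫ fst Z Z') ≫ ψ) ((n ≫ snd Z Z') ≫ ψ') (snd W X ≫ φ)).trans (h.bind_le _)))
      (le_trans (Eq.le ?_) ((bind_seqPair_snd_le hT B
      ((n ≫ fst Z Z') ≫ ψ) ((n ≫ snd Z Z') ≫ ψ') (snd W Y ≫ φ')).trans (h'.bind_le _)))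
    · simp
    · simp

/-- The call-by-name function induced by a call-by-value function. -/
def nameArrow {Z Z' X Y : C} (B : AlgebraOn T Z') (ψ : Z ⟶ T.obj X) (φ' : Y ⟶ Z') :
    (ihom X).obj (T.obj Y) ⟶ (ihom Z).obj Z' :=
  curryR (B.bind (snd _ Z ≫ ψ)
    (B.bind (applyTo (snd _ X) (fst _ _ ≫ fst ((ihom X).obj (T.obj Y)) Z)) (snd _ Y ≫ φ')))

/-- The call-by-value function induced by a call-by-name function. -/
def valueArrow {Z Z' X Y : C} (φ : X ⟶ Z) (ψ' : Z' ⟶ T.obj Y) :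
    (ihom Z).obj Z' ⟶ (ihom X).obj (T.obj Y) :=
  curryR (applyTo (snd _ X ≫ φ) (fst _ _) ≫ ψ')

theorem applyTo_nameArrow {Z Z' X Y W : C} (B : AlgebraOn T Z') (ψ : Z ⟶ T.obj X) (φ' : Y ⟶ Z')
    (x : W ⟶ Z) (f : W ⟶ (ihom X).obj (T.obj Y)) :
    applyTo x (f ≫ nameArrow B ψ φ') =
      B.bind (x ≫ ψ) (B.bind (applyTo (snd W X) (fst W X ≫ f)) (snd _ Y ≫ φ')) := by
  rw [nameArrow, ← curryR_natural, applyTo_curryR, AlgebraOn.comp_bind, AlgebraOn.comp_bind,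
    AlgebraOn.comp_bind, AlgebraOn.comp_bind, comp_applyTo, comp_applyTo]
  simp

theorem applyTo_valueArrow {Z Z' X Y W : C} (φ : X ⟶ Z) (ψ' : Z' ⟶ T.obj Y)
    (x : W ⟶ X) (f : W ⟶ (ihom Z).obj Z') :
    applyTo x (f ≫ valueArrow φ ψ') = applyTo (x ≫ φ) f ≫ ψ' := by
  rw [valueArrow, ← curryR_natural, applyTo_curryR, ← Category.assoc, ← Category.assoc,
    comp_applyTo]
  simp

theorem comp_nameArrow {Z Z' X Y W : C} (B : AlgebraOn T Z') (ψ : Z ⟶ T.obj X) (φ' : Y ⟶ Z')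
    (f : W ⟶ (ihom X).obj (T.obj Y)) :
    f ≫ nameArrow B ψ φ' =
      curryR (B.bind (snd W Z ≫ ψ) (B.bind (applyTo (snd _ X) (fst _ X ≫ fst W Z ≫ f))
        (snd _ Y ≫ φ'))) := by
  rw [← curryR_applyTo (f ≫ nameArrow B ψ φ'), ← Category.assoc, applyTo_nameArrow]

theorem comp_valueArrow {Z Z' X Y W : C} (φ : X ⟶ Z) (ψ' : Z' ⟶ T.obj Y)
    (f : W ⟶ (ihom Z).obj Z') :
    f ≫ valueArrow φ ψ' = curryR (applyTo (snd W X ≫ φ) (fst W X ≫ f) ≫ ψ') := by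
  rw [← curryR_applyTo (f ≫ valueArrow φ ψ'), ← Category.assoc, applyTo_valueArrow]

/-- Application of `f` is a lax homomorphism in its argument, so the sequencing may be moved into
the argument, where the counit bounds it by `x`. -/
theorem IsGaloisPair.bind_applyTo_le (hT : T.LaxIdempotent) {Z Z' : C} {A : AlgebraOn T Z}
    (B : AlgebraOn T Z') {X W : C} {φ : X ⟶ Z} {ψ : Z ⟶ T.obj X} (h : IsGaloisPair A φ ψ)
    (x : W ⟶ Z) (f : W ⟶ (ihom Z).obj Z') :
    B.bind (x ≫ ψ) (applyTo (snd W X ≫ φ) (fst W X ≫ f)) ≤ applyTo x f := by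
  refine le_trans (Eq.le ?_) ((AlgebraOn.bind_lift_le hT A B (x ≫ ψ) (snd W X ≫ φ)
    (applyTo (snd W Z) (fst W Z ≫ f))).trans ?_)
  · rw [comp_applyTo]
    simp
  · rw [comp_applyTo]
    simp only [lift_snd, lift_fst_assoc, Category.id_comp]
    exact applyTo_mono (h.bind_le x) le_rfl

theorem IsGaloisPair.arrow (hT : T.LaxIdempotent) {Z Z' : C} {A : AlgebraOn T Z}
    {B : AlgebraOn T Z'} {X Y : C} {φ : X ⟶ Z} {ψ : Z ⟶ T.obj X} {φ' : Y ⟶ Z'}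
    {ψ' : Z' ⟶ T.obj Y} (h : IsGaloisPair A φ ψ) (h' : IsGaloisPair B φ' ψ') :
    IsGaloisPair (B.exp Z) (nameArrow B ψ φ') (valueArrow φ ψ' ≫ T.unit _) where
  unit_le := by
    set F := (ihom X).obj (T.obj Y)
    rw [← Category.assoc]
    conv_lhs => rw [← Category.id_comp (T.unit F)]
    refine comp_le_comp_right ?_ _
    refine le_of_applyTo_le ?_
    rw [← Category.assoc, applyTo_valueArrow, applyTo_nameArrow]
    -- On the result side: the unit inequality of `h'` inserts φ' followed by ψ', and laxity of ψ'
    -- takes it out of the sequencing.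
    have h₁ : applyTo (snd F X) (fst F X ≫ 𝟙 F) ≤
        B.bind (applyTo (snd F X) (fst F X)) (snd _ Y ≫ φ') ≫ ψ' := by
      refine le_trans ?_ (AlgebraOn.bind_comp_le hT B (AlgebraOn.free T Y) _ _ ψ')
      rw [Category.comp_id, Category.assoc]
      exact (T.bind_snd_unit _).symm.le.trans
        (AlgebraOn.bind_mono _ le_rfl (comp_le_comp_left _ h'.unit_le))
    refine h₁.trans (comp_le_comp_right ?_ ψ')
    -- On the argument side: returning the argument lies below its round trip through φ and ψ.
    have h₂ := B.bind_mono (comp_le_comp_left (snd F X) h.unit_le)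
      (le_refl (B.bind (applyTo (snd _ X) (fst _ X ≫ fst F X)) (snd _ Y ≫ φ')))
    rw [AlgebraOn.bind_unit, AlgebraOn.comp_bind, comp_applyTo] at h₂
    simpa using h₂
  bind_le {W} n := by
    rw [← Category.assoc, AlgebraOn.bind_unit, lift_snd_assoc]
    refine le_of_applyTo_le ?_
    rw [← Category.assoc, applyTo_nameArrow]
    refine le_trans ?_ (h.bind_applyTo_le hT B (snd W Z) (fst W Z ≫ n))
    refine B.bind_mono le_rfl ?_
    rw [← Category.assoc, ← Category.assoc, applyTo_valueArrow]
    -- The counit on results, under the binder for the evaluated argument.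
    have h₁ := h'.bind_le (applyTo (snd (W ⊗ Z) X ≫ φ) (fst (W ⊗ Z) X ≫ fst W Z ≫ n))
    simpa using h₁

end Galois

end CBPV
namespace CBPV

namespace Model

variable {C : Type u} [Category.{v} C] [CartesianMonoidalCategory C] [MonoidalClosed C]
  [CartesianClosedPosetCategory C] (𝓜 : Model C)

-- Conditionals: naturality and monotonicity

section Branch

/-- Case distinction on a morphism into `2`. -/
noncomputable def cond {W Z : C} (b : W ⟶ 𝓜.two) (f g : W ⟶ Z) : W ⟶ Z :=
  lift (𝟙 W) b ≫ 𝓜.branch f g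

theorem comp_cond {W' W Z : C} (h : W' ⟶ W) (b : W ⟶ 𝓜.two) (f g : W ⟶ Z) :
    h ≫ 𝓜.cond b f g = 𝓜.cond (h ≫ b) (h ≫ f) (h ≫ g) := by
  have e : h ▷ 𝓜.two ≫ 𝓜.branch f g = 𝓜.branch (h ≫ f) (h ≫ g) := by
    refine 𝓜.branch_unique _ ?_ ?_
    · have e₁ : lift (𝟙 W') (toUnit W' ≫ 𝓜.inl) ≫ h ▷ 𝓜.two =
          h ≫ lift (𝟙 W) (toUnit W ≫ 𝓜.inl) := by
        ext <;> simp
      rw [← Category.assoc, e₁, Category.assoc, branch_inl]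
    · have e₁ : lift (𝟙 W') (toUnit W' ≫ 𝓜.inr) ≫ h ▷ 𝓜.two =
          h ≫ lift (𝟙 W) (toUnit W ≫ 𝓜.inr) := by
        ext <;> simp
      rw [← Category.assoc, e₁, Category.assoc, branch_inr]
  rw [cond, cond, ← e, ← Category.assoc, ← Category.assoc]
  congr 1
  ext <;> simp

theorem cond_comp {W Z Z' : C} (b : W ⟶ 𝓜.two) (f g : W ⟶ Z) (k : Z ⟶ Z') :
    𝓜.cond b f g ≫ k = 𝓜.cond b (f ≫ k) (g ≫ k) := by
  rw [cond, cond, Category.assoc]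
  congr 1
  refine 𝓜.branch_unique _ ?_ ?_
  · rw [← Category.assoc, branch_inl]
  · rw [← Category.assoc, branch_inr]

/-- Monotone copairing concerns maps out of 2 alone, so the context is first curried away and the
branches compared as points of `W ⇒ Z`. -/
theorem cond_mono {W Z : C} (b : W ⟶ 𝓜.two) {f f' g g' : W ⟶ Z} (hf : f ≤ f') (hg : g ≤ g') :
    𝓜.cond b f g ≤ 𝓜.cond b f' g' := by
  have curry_mono : ∀ {k k' : W ⟶ Z}, k ≤ k' →
      MonoidalClosed.curry (fst W (𝟙_ C) ≫ k) ≤ MonoidalClosed.curry (fst W (𝟙_ C) ≫ k') := by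
    intro k k' hk
    have e : ∀ l : W ⟶ Z, MonoidalClosed.curry (fst W (𝟙_ C) ≫ l) =
        curryR (snd (𝟙_ C) W ≫ l) := fun l => by
      rw [curryR, ← Category.assoc, lift_snd]
    rw [e, e]
    exact curryR_le_curryR (comp_le_comp_left _ hk)
  have h : 𝓜.copair (MonoidalClosed.curry (fst W (𝟙_ C) ≫ f))
      (MonoidalClosed.curry (fst W (𝟙_ C) ≫ g)) ≤ 𝓜.copair (MonoidalClosed.curry
        (fst W (𝟙_ C) ≫ f')) (MonoidalClosed.curry (fst W (𝟙_ C) ≫ g')) := by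
    refine 𝓜.copair_mono ?_ ?_
    · rw [inl_copair, inl_copair]
      exact curry_mono hf
    · rw [inr_copair, inr_copair]
      exact curry_mono hg
  have e : ∀ l : 𝓜.two ⟶ (ihom W).obj Z, W ◁ l = lift (fst W _) (snd W _ ≫ l) := fun l => by
    ext <;> simp
  refine comp_le_comp_left _ (comp_le_comp_right ?_ _)
  rw [e, e]
  exact lift_le_lift le_rfl (comp_le_comp_left _ h)

end Branch

-- Semantic renaming and substitution lemmas

section Interpretation

variable {Γ Δ : Ctx} {A : VTy} {D : CTy}

/-- A morphism of contexts interprets a renaming. -/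
def InterpretsRen (ρ : Ren Γ Δ) (h : 𝓜.ctx Δ ⟶ 𝓜.ctx Γ) : Prop :=
  ∀ (A : VTy) (x : Var Γ A), h ≫ 𝓜.var x = 𝓜.var (ρ A x)

/-- A morphism of contexts interprets a substitution. -/
def InterpretsSub (σ : Sub Γ Δ) (h : 𝓜.ctx Δ ⟶ 𝓜.ctx Γ) : Prop :=
  ∀ (A : VTy) (x : Var Γ A), h ≫ 𝓜.var x = 𝓜.val (σ A x)

variable {𝓜}

theorem InterpretsRen.lift {ρ : Ren Γ Δ} {h : 𝓜.ctx Δ ⟶ 𝓜.ctx Γ} (H : 𝓜.InterpretsRen ρ h)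
    (B : VTy) : 𝓜.InterpretsRen (ρ.lift B) (h ▷ 𝓜.vty B) := by
  intro A x
  cases x with
  | z => exact whiskerRight_snd _ _
  | s x =>
    refine (whiskerRight_fst_assoc h (𝓜.vty B) (𝓜.var x)).trans ?_
    rw [H]
    rfl

variable (𝓜)

theorem interpretsRen_wk (Γ : Ctx) (B : VTy) :
    𝓜.InterpretsRen (Γ := Γ) (Δ := B :: Γ) (fun _ x => .s x) (fst (𝓜.ctx Γ) (𝓜.vty B)) :=
  fun _ _ => rfl

mutual

theorem val_rename : ∀ {Γ Δ : Ctx} {A : VTy} (V : Val Γ A) {ρ : Ren Γ Δ}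
    {h : 𝓜.ctx Δ ⟶ 𝓜.ctx Γ}, 𝓜.InterpretsRen ρ h → 𝓜.val (V.rename ρ) = h ≫ 𝓜.val V
  | _, _, _, .var x, _, _, H => (H _ x).symm
  | _, _, _, .unit, _, _, _ => toUnit_unique _ _
  | _, _, _, .pair V W, _, _, H =>
      (congrArg₂ lift (val_rename V H) (val_rename W H)).trans (comp_lift _ _ _).symm
  | _, _, _, .true, _, h, _ => by
      refine Eq.trans ?_ (Category.assoc h (toUnit _) 𝓜.inl)
      rw [toUnit_unique (h ≫ toUnit _) (toUnit _)]
      rfl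
  | _, _, _, .false, _, h, _ => by
      refine Eq.trans ?_ (Category.assoc h (toUnit _) 𝓜.inr)
      rw [toUnit_unique (h ≫ toUnit _) (toUnit _)]
      rfl
  | _, _, _, .thunk M, _, _, H => comp_rename M H

theorem comp_rename : ∀ {Γ Δ : Ctx} {D : CTy} (M : Comp Γ D) {ρ : Ren Γ Δ}
    {h : 𝓜.ctx Δ ⟶ 𝓜.ctx Γ}, 𝓜.InterpretsRen ρ h → 𝓜.comp (M.rename ρ) = h ≫ 𝓜.comp M
  | _, _, _, .pair M N, _, _, H =>
      (congrArg₂ lift (comp_rename M H) (comp_rename N H)).trans (comp_lift _ _ _).symm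
  | _, _, _, .proj₁ M, _, h, H =>
      (congrArg (· ≫ fst _ _) (comp_rename M H)).trans (Category.assoc _ _ _)
  | _, _, _, .proj₂ M, _, h, H =>
      (congrArg (· ≫ snd _ _) (comp_rename M H)).trans (Category.assoc _ _ _)
  | _, _, _, .lam M, _, h, H =>
      (congrArg curryR (comp_rename M (H.lift _))).trans (curryR_natural _ _)
  | _, _, _, .app V M, _, h, H =>
      (congrArg₂ applyTo (val_rename V H) (comp_rename M H)).trans (comp_applyTo _ _ _).symm
  | _, _, _, .ret V, _, h, H =>
      (congrArg (· ≫ 𝓜.T.unit _) (val_rename V H)).trans (Category.assoc _ _ _)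
  | _, _, _, .to (D := D) M N, _, h, H =>
      (congrArg₂ (𝓜.cty D).on.bind (comp_rename M H) (comp_rename N (H.lift _))).trans
        (AlgebraOn.comp_bind _ _ _ _).symm
  | _, _, _, .matchPair V M, _, h, H =>
      (congrArg₂ (fun v m => CartesianMonoidalCategory.lift (𝟙 _) v ≫ (α_ _ _ _).inv ≫ m)
        (val_rename V H) (comp_rename M ((H.lift _).lift _))).trans (comp_split _ _ _).symm
  | _, _, _, .ite V M N, _, h, H => by
      refine Eq.trans ?_ (𝓜.comp_cond h _ _ _).symm
      exact congr (congrArg₂ 𝓜.cond (val_rename V H) (comp_rename M H)) (comp_rename N H)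
  | _, _, _, .force V, _, _, H => val_rename V H

end

theorem val_wk (V : Val Γ A) (B : VTy) :
    𝓜.val (V.wk (B := B)) = fst (𝓜.ctx Γ) (𝓜.vty B) ≫ 𝓜.val V :=
  𝓜.val_rename V (𝓜.interpretsRen_wk Γ B)

theorem comp_wk (M : Comp Γ D) (B : VTy) :
    𝓜.comp (M.wk (B := B)) = fst (𝓜.ctx Γ) (𝓜.vty B) ≫ 𝓜.comp M :=
  𝓜.comp_rename M (𝓜.interpretsRen_wk Γ B)

variable {𝓜}

theorem InterpretsSub.lift {σ : Sub Γ Δ} {h : 𝓜.ctx Δ ⟶ 𝓜.ctx Γ} (H : 𝓜.InterpretsSub σ h)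
    (B : VTy) : 𝓜.InterpretsSub (σ.lift B) (h ▷ 𝓜.vty B) := by
  intro A x
  cases x with
  | z => exact whiskerRight_snd _ _
  | s x =>
    refine (whiskerRight_fst_assoc h (𝓜.vty B) (𝓜.var x)).trans ?_
    rw [H]
    exact (𝓜.val_wk _ B).symm

variable (𝓜)

mutual

theorem val_subst : ∀ {Γ Δ : Ctx} {A : VTy} (V : Val Γ A) {σ : Sub Γ Δ}
    {h : 𝓜.ctx Δ ⟶ 𝓜.ctx Γ}, 𝓜.InterpretsSub σ h → 𝓜.val (V.subst σ) = h ≫ 𝓜.val V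
  | _, _, _, .var x, _, _, H => (H _ x).symm
  | _, _, _, .unit, _, _, _ => toUnit_unique _ _
  | _, _, _, .pair V W, _, _, H =>
      (congrArg₂ lift (val_subst V H) (val_subst W H)).trans (comp_lift _ _ _).symm
  | _, _, _, .true, _, h, _ => by
      refine Eq.trans ?_ (Category.assoc h (toUnit _) 𝓜.inl)
      rw [toUnit_unique (h ≫ toUnit _) (toUnit _)]
      rfl
  | _, _, _, .false, _, h, _ => by
      refine Eq.trans ?_ (Category.assoc h (toUnit _) 𝓜.inr)
      rw [toUnit_unique (h ≫ toUnit _) (toUnit _)]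
      rfl
  | _, _, _, .thunk M, _, _, H => comp_subst M H

theorem comp_subst : ∀ {Γ Δ : Ctx} {D : CTy} (M : Comp Γ D) {σ : Sub Γ Δ}
    {h : 𝓜.ctx Δ ⟶ 𝓜.ctx Γ}, 𝓜.InterpretsSub σ h → 𝓜.comp (M.subst σ) = h ≫ 𝓜.comp M
  | _, _, _, .pair M N, _, _, H =>
      (congrArg₂ lift (comp_subst M H) (comp_subst N H)).trans (comp_lift _ _ _).symm
  | _, _, _, .proj₁ M, _, h, H =>
      (congrArg (· ≫ fst _ _) (comp_subst M H)).trans (Category.assoc _ _ _)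
  | _, _, _, .proj₂ M, _, h, H =>
      (congrArg (· ≫ snd _ _) (comp_subst M H)).trans (Category.assoc _ _ _)
  | _, _, _, .lam M, _, h, H =>
      (congrArg curryR (comp_subst M (H.lift _))).trans (curryR_natural _ _)
  | _, _, _, .app V M, _, h, H =>
      (congrArg₂ applyTo (val_subst V H) (comp_subst M H)).trans (comp_applyTo _ _ _).symm
  | _, _, _, .ret V, _, h, H =>
      (congrArg (· ≫ 𝓜.T.unit _) (val_subst V H)).trans (Category.assoc _ _ _)
  | _, _, _, .to (D := D) M N, _, h, H =>
      (congrArg₂ (𝓜.cty D).on.bind (comp_subst M H) (comp_subst N (H.lift _))).trans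
        (AlgebraOn.comp_bind _ _ _ _).symm
  | _, _, _, .matchPair V M, _, h, H =>
      (congrArg₂ (fun v m => CartesianMonoidalCategory.lift (𝟙 _) v ≫ (α_ _ _ _).inv ≫ m)
        (val_subst V H) (comp_subst M ((H.lift _).lift _))).trans (comp_split _ _ _).symm
  | _, _, _, .ite V M N, _, h, H => by
      refine Eq.trans ?_ (𝓜.comp_cond h _ _ _).symm
      exact congr (congrArg₂ 𝓜.cond (val_subst V H) (comp_subst M H)) (comp_subst N H)
  | _, _, _, .force V, _, _, H => val_subst V H

end

end Interpretation

end Model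

end CBPV
namespace CBPV

-- Inductive steps of the comparison, one per term former

section Comparison

variable {C : Type u} [Category.{v} C] [CartesianMonoidalCategory C] [MonoidalClosed C]
  [CartesianClosedPosetCategory C] {T : StrongMonad C}

/-- In this and the following lemmas `W` and `V` stand for the call-by-value and call-by-name
contexts, `s` for the substitution between them, and the inequalities assumed are the induction
hypotheses. -/
theorem seqPair_le_lift {W V Z Z' X Y : C} {ψ : Z ⟶ T.obj X} {ψ' : Z' ⟶ T.obj Y}
    {m : W ⟶ T.obj X} {m' : W ⟶ T.obj Y} {s : W ⟶ V} {n : V ⟶ Z} {n' : V ⟶ Z'}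
    (h : m ≤ s ≫ n ≫ ψ) (h' : m' ≤ s ≫ n' ≫ ψ') :
    T.seqPair m m' ≤ s ≫ lift n n' ≫ T.seqPair (fst Z Z' ≫ ψ) (snd Z Z' ≫ ψ') := by
  rw [comp_seqPair, comp_seqPair, lift_fst_assoc, lift_snd_assoc]
  exact seqPair_mono h h'

theorem bind_fst_le_fst (hT : T.LaxIdempotent) {W V Z Z' X Y : C} {ψ : Z ⟶ T.obj X}
    {ψ' : Z' ⟶ T.obj Y} {m : W ⟶ T.obj (X ⊗ Y)} {s : W ⟶ V} {n : V ⟶ Z ⊗ Z'}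
    (h : m ≤ s ≫ n ≫ T.seqPair (fst Z Z' ≫ ψ) (snd Z Z' ≫ ψ')) :
    T.bind m (lift (𝟙 _) (snd W (X ⊗ Y)) ≫ (α_ _ X Y).inv ≫ (fst _ _ ≫ snd _ _) ≫ T.unit X) ≤
      s ≫ (n ≫ fst Z Z') ≫ ψ := by
  have e : lift (𝟙 _) (snd W (X ⊗ Y)) ≫ (α_ _ X Y).inv ≫ (fst _ _ ≫ snd _ _) ≫ T.unit X =
      W ◁ fst X Y ≫ snd W X ≫ T.unit X := by
    simp
  rw [comp_seqPair, comp_seqPair] at h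
  rw [e]
  refine (AlgebraOn.bind_mono _ h le_rfl).trans ((bind_seqPair_fst_le hT _ _ _ _).trans ?_)
  refine (T.bind_snd_unit _).le.trans ?_
  rw [Category.assoc]

theorem bind_snd_le_snd (hT : T.LaxIdempotent) {W V Z Z' X Y : C} {ψ : Z ⟶ T.obj X}
    {ψ' : Z' ⟶ T.obj Y} {m : W ⟶ T.obj (X ⊗ Y)} {s : W ⟶ V} {n : V ⟶ Z ⊗ Z'}
    (h : m ≤ s ≫ n ≫ T.seqPair (fst Z Z' ≫ ψ) (snd Z Z' ≫ ψ')) :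
    T.bind m (lift (𝟙 _) (snd W (X ⊗ Y)) ≫ (α_ _ X Y).inv ≫ snd _ _ ≫ T.unit Y) ≤
      s ≫ (n ≫ snd Z Z') ≫ ψ' := by
  have e : lift (𝟙 _) (snd W (X ⊗ Y)) ≫ (α_ _ X Y).inv ≫ snd _ _ ≫ T.unit Y =
      W ◁ snd X Y ≫ snd W Y ≫ T.unit Y := by
    simp
  rw [comp_seqPair, comp_seqPair] at h
  rw [e]
  refine (AlgebraOn.bind_mono _ h le_rfl).trans ((bind_seqPair_snd_le hT _ _ _ _).trans ?_)
  refine (T.bind_snd_unit _).le.trans ?_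
  rw [Category.assoc]

/-- The substitution for the extended context applies φ to the bound variable, which is exactly what
`valueArrow` does to its argument; the rest is an equation. -/
theorem curryR_unit_le {W V Z Z' X Y : C} {φ : X ⟶ Z} {ψ' : Z' ⟶ T.obj Y}
    {m : W ⊗ X ⟶ T.obj Y} {s : W ⟶ V} {n : V ⊗ Z ⟶ Z'}
    (h : m ≤ lift (fst W X ≫ s) (snd W X ≫ φ) ≫ n ≫ ψ') :
    curryR m ≫ T.unit _ ≤ s ≫ curryR n ≫ valueArrow φ ψ' ≫ T.unit _ := by
  rw [← Category.assoc (curryR n), ← Category.assoc s, comp_valueArrow, ← curryR_natural]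
  refine comp_le_comp_right (curryR_le_curryR (h.trans (Eq.le ?_))) _
  have e : lift (𝟙 (V ⊗ X)) (snd V X ≫ φ) ≫ fst V X ▷ Z = V ◁ φ := by
    ext <;> simp
  rw [← curryR_natural, applyTo_curryR, ← Category.assoc (lift (𝟙 _) _), e]
  simp only [← Category.assoc]
  congr 2
  ext <;> simp

/-- The bound on the function part is a return, so the first sequencing is a β-step. Laxity then
moves ψ' outside the evaluation of the argument, and `IsGaloisPair.bind_applyTo_le` replaces the
evaluated argument by the unevaluated one. -/
theorem bind_applyTo_le_applyTo (hT : T.LaxIdempotent) {W V Z Z' X Y : C} {A : AlgebraOn T Z}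
    (B : AlgebraOn T Z') {φ : X ⟶ Z} {ψ : Z ⟶ T.obj X} {ψ' : Z' ⟶ T.obj Y}
    (hφ : IsGaloisPair A φ ψ) {m : W ⟶ T.obj ((ihom X).obj (T.obj Y))} {m' : W ⟶ T.obj X}
    {s : W ⟶ V} {n : V ⟶ (ihom Z).obj Z'} {n' : V ⟶ Z}
    (h : m ≤ s ≫ n ≫ valueArrow φ ψ' ≫ T.unit _) (h' : m' ≤ s ≫ n' ≫ ψ) :
    T.bind m (T.bind (fst _ _ ≫ m') (applyTo (snd _ _) (fst _ _ ≫ snd _ _))) ≤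
      s ≫ applyTo n' n ≫ ψ' := by
  have h₁ : T.bind m (T.bind (fst _ _ ≫ m') (applyTo (snd _ _) (fst _ _ ≫ snd _ _))) ≤
      T.bind ((s ≫ n ≫ valueArrow φ ψ') ≫ T.unit _)
        (T.bind (fst _ _ ≫ s ≫ n' ≫ ψ) (applyTo (snd _ _) (fst _ _ ≫ snd _ _))) := by
    refine AlgebraOn.bind_mono _ (h.trans (by simp)) ?_
    exact AlgebraOn.bind_mono _ (comp_le_comp_left _ h') le_rfl
  refine h₁.trans ?_
  rw [StrongMonad.bind, AlgebraOn.bind_unit, AlgebraOn.comp_bind, comp_applyTo]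
  simp only [lift_fst_assoc, Category.id_comp, whiskerRight_snd, whiskerRight_fst_assoc, lift_snd]
  have e : applyTo (snd W X) (fst W X ≫ s ≫ n ≫ valueArrow φ ψ') =
      applyTo (snd W X ≫ φ) (fst W X ≫ s ≫ n) ≫ ψ' := by
    rw [← applyTo_valueArrow]
    simp
  rw [e, ← Category.assoc s (applyTo _ _), comp_applyTo, ← Category.assoc s n']
  exact (AlgebraOn.bind_comp_le hT B (AlgebraOn.free T Y) _ _ _).trans
    (comp_le_comp_right (hφ.bind_applyTo_le hT B (s ≫ n') (s ≫ n)) _)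

/-- The two branches end in ψ, which factors out of the case distinction exactly and out of the
sequencing laxly. -/
theorem bind_cond_le (𝓜 : Model C) (hT : 𝓜.T.LaxIdempotent) {W V Z X : C}
    (A : AlgebraOn 𝓜.T Z) {ψ : Z ⟶ 𝓜.T.obj X} {m : W ⟶ 𝓜.T.obj 𝓜.two} {m₁ m₂ : W ⟶ 𝓜.T.obj X}
    {s : W ⟶ V} {n : V ⟶ 𝓜.T.obj 𝓜.two} {n₁ n₂ : V ⟶ Z}
    (h : m ≤ s ≫ n ≫ 𝟙 _) (h₁ : m₁ ≤ s ≫ n₁ ≫ ψ) (h₂ : m₂ ≤ s ≫ n₂ ≫ ψ) :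
    𝓜.T.bind m (𝓜.cond (snd _ _) (fst _ _ ≫ m₁) (fst _ _ ≫ m₂)) ≤
      s ≫ A.bind n (𝓜.cond (snd _ _) (fst _ _ ≫ n₁) (fst _ _ ≫ n₂)) ≫ ψ := by
  rw [Category.comp_id] at h
  rw [← Category.assoc, AlgebraOn.comp_bind, 𝓜.comp_cond]
  refine le_trans ?_ (AlgebraOn.bind_comp_le hT A (AlgebraOn.free _ X) _ _ _)
  refine AlgebraOn.bind_mono _ h ?_
  rw [𝓜.cond_comp, whiskerRight_snd]
  refine 𝓜.cond_mono _ ?_ ?_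
  · simpa using comp_le_comp_left _ h₁
  · simpa using comp_le_comp_left _ h₂

end Comparison

-- Denotations of the comparison maps and the induction on expressions

namespace Model

variable {C : Type u} [Category.{v} C] [CartesianMonoidalCategory C] [MonoidalClosed C]
  [CartesianClosedPosetCategory C] (𝓜 : Model C)

mutual

/-- The interpretation of `toNameHat`. -/
noncomputable def nameMap : (τ : Ty) → (𝓜.vty τ.cbv ⟶ (𝓜.cty τ.cbn).carrier)
  | .unit => 𝓜.T.unit (𝟙_ C)
  | .prod τ₁ τ₂ =>
      lift (fst (𝓜.vty τ₁.cbv) (𝓜.vty τ₂.cbv) ≫ nameMap τ₁)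
        (snd (𝓜.vty τ₁.cbv) (𝓜.vty τ₂.cbv) ≫ nameMap τ₂)
  | .bool => 𝓜.T.unit 𝓜.two
  | .arr τ τ' => nameArrow (𝓜.cty τ'.cbn).on (valueMap τ) (nameMap τ')

/-- The interpretation of `toValue`. -/
noncomputable def valueMap : (τ : Ty) → ((𝓜.cty τ.cbn).carrier ⟶ 𝓜.T.obj (𝓜.vty τ.cbv))
  | .unit => 𝟙 (𝓜.T.obj (𝟙_ C))
  | .prod τ₁ τ₂ =>
      𝓜.T.seqPair (fst (𝓜.cty τ₁.cbn).carrier (𝓜.cty τ₂.cbn).carrier ≫ valueMap τ₁)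
        (snd (𝓜.cty τ₁.cbn).carrier (𝓜.cty τ₂.cbn).carrier ≫ valueMap τ₂)
  | .bool => 𝟙 (𝓜.T.obj 𝓜.two)
  | .arr τ τ' => valueArrow (nameMap τ) (valueMap τ') ≫ 𝓜.T.unit _

end

theorem isGaloisPair_nameMap_valueMap (hT : 𝓜.T.LaxIdempotent) :
    ∀ τ : Ty, IsGaloisPair (𝓜.cty τ.cbn).on (𝓜.nameMap τ) (𝓜.valueMap τ)
  | .unit => isGaloisPair_free 𝓜.T (𝟙_ C)
  | .prod τ₁ τ₂ =>
      (isGaloisPair_nameMap_valueMap hT τ₁).prod hT (isGaloisPair_nameMap_valueMap hT τ₂)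
  | .bool => isGaloisPair_free 𝓜.T 𝓜.two
  | .arr τ τ' =>
      (isGaloisPair_nameMap_valueMap hT τ).arrow hT (isGaloisPair_nameMap_valueMap hT τ')

mutual

theorem comp_toNameHat : ∀ (τ : Ty) {Γ : Ctx} (V : Val Γ τ.cbv),
    𝓜.comp (toNameHat τ V) = 𝓜.val V ≫ 𝓜.nameMap τ
  | .unit, _, _ => rfl
  | .prod τ₁ τ₂, Γ, V => by
      refine Eq.trans ?_ (lift_id_assocInv_lift (𝓜.val V) (𝓜.nameMap τ₁) (𝓜.nameMap τ₂))
      exact congrArg₂ (fun f g => lift (𝟙 (𝓜.ctx Γ)) (𝓜.val V) ≫ (α_ _ _ _).inv ≫ lift f g)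
        (comp_toNameHat τ₁ (.var (.s .z))) (comp_toNameHat τ₂ (.var .z))
  | .bool, _, _ => rfl
  | .arr τ τ', Γ, V => by
      refine Eq.trans ?_ (comp_nameArrow (𝓜.cty τ'.cbn).on (𝓜.valueMap τ) (𝓜.nameMap τ')
        (𝓜.val V)).symm
      -- `V` is used below two binders: the thunked argument and its value.
      have e : 𝓜.val (V.wk.wk (B := τ.cbv)) =
          fst _ (𝓜.vty τ.cbv) ≫ fst (𝓜.ctx Γ) (𝓜.vty (.U τ.cbn)) ≫ 𝓜.val V := by
        rw [val_wk, val_wk]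
        rfl
      exact congrArg curryR (congrArg₂ (𝓜.cty τ'.cbn).on.bind
        (comp_toValue τ (.force (.var .z)))
        (congrArg₂ (𝓜.cty τ'.cbn).on.bind (congrArg (applyTo (snd _ (𝓜.vty τ.cbv))) e)
          (comp_toNameHat τ' (.var .z))))

theorem comp_toValue : ∀ (τ : Ty) {Γ : Ctx} (N : Comp Γ τ.cbn),
    𝓜.comp (toValue τ N) = 𝓜.comp N ≫ 𝓜.valueMap τ
  | .unit, _, _ => (Category.comp_id _).symm
  | .prod τ₁ τ₂, Γ, N => by
      refine Eq.trans ?_ (comp_seqPair (𝓜.comp N) _ _).symm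
      refine congrArg₂ 𝓜.T.bind ((comp_toValue τ₁ (.proj₁ N)).trans (Category.assoc _ _ _)) ?_
      refine congrArg (𝓜.T.bind · _) ((comp_toValue τ₂ (.proj₂ N.wk)).trans ?_)
      refine (congrArg (fun k => (k ≫ snd (𝓜.cty τ₁.cbn).carrier (𝓜.cty τ₂.cbn).carrier) ≫
        𝓜.valueMap τ₂) (𝓜.comp_wk N _)).trans ?_
      exact (Category.assoc _ _ _).trans (Category.assoc _ _ _)
  | .bool, _, _ => (Category.comp_id _).symm
  | .arr τ τ', Γ, N => by
      refine Eq.trans ?_ ((congrArg (· ≫ 𝓜.T.unit _)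
        (comp_valueArrow (𝓜.nameMap τ) (𝓜.valueMap τ') (𝓜.comp N)).symm).trans
          (Category.assoc _ _ _))
      refine congrArg (curryR · ≫ 𝓜.T.unit _) ((comp_toValue τ' _).trans ?_)
      exact congrArg₂ (applyTo · · ≫ 𝓜.valueMap τ') (comp_toNameHat τ (.var .z)) (𝓜.comp_wk N _)

end

/-- The interpretation of `toNameSub`. -/
noncomputable def nameSubMap : (Γ : List Ty) → (𝓜.ctx (cbvCtx Γ) ⟶ 𝓜.ctx (cbnCtx Γ))
  | [] => 𝟙 (𝟙_ C)
  | τ :: Γ =>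
      lift (fst (𝓜.ctx (cbvCtx Γ)) (𝓜.vty τ.cbv) ≫ nameSubMap Γ)
        (snd (𝓜.ctx (cbvCtx Γ)) (𝓜.vty τ.cbv) ≫ 𝓜.nameMap τ)

theorem interpretsSub_toNameSub :
    ∀ Γ : List Ty, 𝓜.InterpretsSub (toNameSub Γ) (𝓜.nameSubMap Γ)
  | [], _, x => nomatch x
  | τ :: Γ, _, .z => (lift_snd _ _).trans
      (𝓜.comp_toNameHat τ (.var (.z : Var (cbvCtx (τ :: Γ)) τ.cbv))).symm
  | τ :: Γ, A, .s x =>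
      (lift_fst_assoc _ _ _).trans ((Category.assoc _ _ _).trans
        ((congrArg (fst _ _ ≫ ·) (interpretsSub_toNameSub Γ A x)).trans (𝓜.val_wk _ τ.cbv).symm))

/-- For the variable case of `comp_cbv_le`: a substituted variable has denotation φ of the original
one. -/
theorem nameSubMap_var : ∀ {Γ : List Ty} {τ : Ty} (x : Var Γ τ),
    𝓜.nameSubMap Γ ≫ 𝓜.var (x.map fun τ => VTy.U τ.cbn) =
      𝓜.var (x.map Ty.cbv) ≫ 𝓜.nameMap τ
  | _, _, .z => lift_snd _ _
  | _, _, .s x =>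
      (lift_fst_assoc _ _ _).trans ((Category.assoc _ _ _).trans
        ((congrArg (fst _ _ ≫ ·) (nameSubMap_var x)).trans (Category.assoc _ _ _).symm))

/-- The interpretation of the call-by-value translation is below that of the call-by-name
translation. -/
theorem comp_cbv_le (hT : 𝓜.T.LaxIdempotent) : ∀ {Γ : List Ty} {τ : Ty} (e : Expr Γ τ),
    𝓜.comp e.cbv ≤ 𝓜.nameSubMap Γ ≫ 𝓜.comp e.cbn ≫ 𝓜.valueMap τ
  | Γ, τ, .var x => by
      -- For a variable the claim is the unit inequality η ≤ ψ ∘ φ of the Galois pair.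
      refine (comp_le_comp_left (𝓜.var (x.map Ty.cbv))
        (𝓜.isGaloisPair_nameMap_valueMap hT τ).unit_le).trans (Eq.le ?_)
      exact (Category.assoc _ _ _).symm.trans ((congrArg (· ≫ 𝓜.valueMap τ)
        (𝓜.nameSubMap_var x).symm).trans (Category.assoc _ _ _))
  | Γ, _, .unit => (comp_toUnit_comp (𝓜.nameSubMap Γ) (𝓜.T.unit (𝟙_ C))).symm.le
  | _, _, .pair (τ₁ := τ₁) (τ₂ := τ₂) e₁ e₂ => by
      refine le_trans (Eq.le ?_) (seqPair_le_lift (comp_cbv_le hT e₁) (comp_cbv_le hT e₂))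
      exact congrArg (fun k => 𝓜.T.bind (𝓜.comp e₁.cbv) (𝓜.T.bind k _)) (𝓜.comp_wk e₂.cbv _)
  | _, _, .fst e => bind_fst_le_fst hT (comp_cbv_le hT e)
  | _, _, .snd e => bind_snd_le_snd hT (comp_cbv_le hT e)
  | Γ, _, .true => by
      have h := (comp_toUnit_comp (𝓜.nameSubMap Γ) (𝓜.inl ≫ 𝓜.T.unit 𝓜.two)).symm.le
      rwa [← Category.assoc (toUnit _), ← Category.assoc (toUnit _)] at h
  | Γ, _, .false => by
      have h := (comp_toUnit_comp (𝓜.nameSubMap Γ) (𝓜.inr ≫ 𝓜.T.unit 𝓜.two)).symm.le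
      rwa [← Category.assoc (toUnit _), ← Category.assoc (toUnit _)] at h
  | _, _, .ite (τ := τ) e₀ e₁ e₂ => by
      refine le_trans (Eq.le ?_) ((bind_cond_le 𝓜 hT (𝓜.cty τ.cbn).on (comp_cbv_le hT e₀)
        (comp_cbv_le hT e₁) (comp_cbv_le hT e₂)).trans (Eq.le ?_))
      · exact congrArg₂ (fun k l => 𝓜.T.bind (𝓜.comp e₀.cbv) (𝓜.cond (snd _ _) k l))
          (𝓜.comp_wk e₁.cbv _) (𝓜.comp_wk e₂.cbv _)
      · exact congrArg₂ (fun k l => 𝓜.nameSubMap _ ≫ (𝓜.cty τ.cbn).on.bind (𝓜.comp e₀.cbn)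
          (𝓜.cond (snd _ _) k l) ≫ 𝓜.valueMap τ)
          (𝓜.comp_wk e₁.cbn .bool).symm (𝓜.comp_wk e₂.cbn .bool).symm
  | _, _, .lam e => curryR_unit_le (comp_cbv_le hT e)
  | _, _, .app (τ := τ) (τ' := τ') e e' => by
      refine le_trans (Eq.le ?_) (bind_applyTo_le_applyTo hT (𝓜.cty τ'.cbn).on
        (𝓜.isGaloisPair_nameMap_valueMap hT τ) (comp_cbv_le hT e) (comp_cbv_le hT e'))
      exact congrArg (fun k => 𝓜.T.bind (𝓜.comp e.cbv) (𝓜.T.bind k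
        (applyTo (snd _ _) (fst _ _ ≫ snd _ _)))) (𝓜.comp_wk e'.cbv _)

end Model

end CBPV

theorem mainTheorem1 {C : Type u} [Category.{v} C] [CartesianMonoidalCategory C]
    [MonoidalClosed C] [CartesianClosedPosetCategory C]
    (R : CBPV.ProgramRelation) (𝓜 : CBPV.Model C)
    (hadequate : 𝓜.Adequate R) (hlax : 𝓜.T.LaxIdempotent)
    {Γ : List CBPV.Ty} {τ : CBPV.Ty} (e : CBPV.Expr Γ τ) :
    CBPV.CtxLE R e.cbv (CBPV.toValue τ (e.cbn.subst (CBPV.toNameSub Γ))) := by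
  refine hadequate _ _ ((𝓜.comp_cbv_le hlax e).trans (Eq.le ?_))
  rw [𝓜.comp_toValue, 𝓜.comp_subst e.cbn (𝓜.interpretsSub_toNameSub Γ), Category.assoc]
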